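/- Let $q_0=(\tfrac12,\tfrac{\sqrt3}{2})$, $q_1=(0,0)$, $q_2=(1,0)$, $F_i(z)=\tfrac12(z+q_i)$, and let $\mathcal{SG}$ be the Sierpinski gasket, i.e. the unique nonempty compact $K\subset\mathbb R^2$ with $K=\bigcup_{i=0}^2F_iK$. For a word $w=w_1\cdots w_m\in\{0,1,2\}^m$ write $F_w=F_{w_1}\circ\cdots\circ F_{w_m}$ and $|w|=m$. Put $r=\tfrac35$ and $$\mathcal E_m(u,v)=r^{-m}\sum_{x\sim_my}(u(x)-u(y))(v(x)-v(y)),\qquad \mathcal E(u,v)=\lim_{m\to\infty}\mathcal E_m(u,v),$$ where the sum is over the edges of the triangles $F_w\{q_0,q_1,q_2\}$, $|w|=m$; a continuous $v$ on $\mathcal{SG}$ belongs to $\mathrm{dom}\,\mathcal E$ if $\mathcal E(v,v)<\infty$. Let $\Omega=\{x\in\mathcal{SG}:x_1<\tfrac12\}\setminus\{q_1\}$ (with $x_1$ the first coordinate of $x$) be the left half domain of $\mathcal{SG}$, let $X=\{x\in\mathcal{SG}:x_1=\tfrac12\}$ and $\partial\Omega=\{q_1\}\cup X$, and let $p_k=F_0^kF_1q_2\in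 X$ for $k\ge 0$. For $f\in C(\partial\Omega)$, a solution of the Dirichlet problem with boundary data $f$ is a continuous function $u$ on $\Omega\cup\partial\Omega$ with $u|_{\partial\Omega}=f$ and $\Delta u=0$ in $\Omega$; the latter means that $u\circ F_w$ has finite energy whenever $F_w\mathcal{SG}\subset\Omega$, and $\mathcal E(u,v)=0$ for all $v\in\mathrm{dom}\,\mathcal E$ vanishing outside a compact subset of $\Omega$. The normal derivative of $u$ at $F_wq_i$ with respect to the cell $F_w\mathcal{SG}$ is $$r^{-|w|}\lim_{m\to\infty}r^{-m}\big(2u(F_wq_i)-u(F_wF_i^mq_{i+1})-u(F_wF_i^mq_{i-1})\big)$$ (indices mod $3$), if the limit exists. Let $\partial_n^{\leftarrow}u(q_1)$ be the normal derivative at $q_1$ (with $w=\emptyset$, $i=1$) and let $\partial_n^{\rightarrow}u(p_k)$ be the normal derivative at $p_k$ with respect to the cell $F_0^kF_1\mathcal{SG}$ (with $i=2$). **Theorem 5.3.** (a) Let $f\in C(\partial\Omega)$ and let $u$ be the solution of the Dirichlet problem with boundary data $f$. Then the normal derivatives $\partial_n^{\rightarrow}u(p_k)$, $k\ge0$, exist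 and the series $\sum_{k=0}^\infty(\tfrac35)^{k+1}\partial_n^{\rightarrow}u(p_k)$ converges. (b) Conversely, for every convergent series $\sum_{k=-1}^\infty\eta_k$ of real numbers there exists a unique $f\in C(\partial\Omega)$ such that $f(q_1)=0$, $\partial_n^{\leftarrow}u(q_1)=\eta_{-1}$ and $\partial_n^{\rightarrow}u(p_k)=(\tfrac53)^{k+1}\eta_k$ for all $k\ge0$, where $u$ is the solution of the Dirichlet problem with boundary data $f$. -/

import Mathlib

open Filter Topology Set

noncomputable section

namespace SierpinskiHalf

/-- The Euclidean plane. -/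
abbrev Plane : Type := EuclideanSpace ℝ (Fin 2)

/-- The vertices of the triangle: `q 0` is the top, `q 1` the left and `q 2` the right vertex. -/
def q : Fin 3 → Plane :=
  ![!₂[1 / 2, Real.sqrt 3 / 2], !₂[0, 0], !₂[1, 0]]

/-- The contraction `F i` of ratio `1/2` with fixed point `q i`. -/
def F (i : Fin 3) (x : Plane) : Plane := (1 / 2 : ℝ) • (x + q i)

/-- `F_w = F_{w₁} ∘ ⋯ ∘ F_{wₘ}` for a word `w = w₁ ⋯ wₘ`. -/
def cellMap : List (Fin 3) → Plane → Plane
  | [] => id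
  | i :: w => F i ∘ cellMap w

/-- The vertex set `V_*`, that is, all points `F_w q_i`. -/
def vertices : Set Plane := {x | ∃ (w : List (Fin 3)) (i : Fin 3), x = cellMap w (q i)}

/-- The Sierpinski gasket, as the closure of `V_*`. The lemmas `isCompact_SG`, `SG_nonempty`,
`SG_eq_iUnion` and `SG_unique` below identify it as the unique nonempty compact set `K` with
`K = F₀ K ∪ F₁ K ∪ F₂ K`. -/
def SG : Set Plane := closure vertices

/-- The energy renormalization factor of the Sierpinski gasket. -/
def r : ℝ := 3 / 5

/-- The graph energy on one triangle, each of the three edges being counted once. -/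
def energy₀ (u v : Plane → ℝ) : ℝ :=
  (u (q 0) - u (q 1)) * (v (q 0) - v (q 1))
    + (u (q 1) - u (q 2)) * (v (q 1) - v (q 2))
    + (u (q 2) - u (q 0)) * (v (q 2) - v (q 0))

/-- The level `m` graph energy
`E_m(u, v) = r⁻ᵐ ∑_{x ∼ₘ y} (u x - u y) (v x - v y)`; every edge `x ∼ₘ y` belongs to exactly one
`m`-cell, so the sum over edges is the sum over the words of length `m` of the energies on the
triangles `F_w V_0`. -/
def graphEnergy (m : ℕ) (u v : Plane → ℝ) : ℝ :=
  (r⁻¹) ^ m * ∑ w : Fin m → Fin 3,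
    energy₀ (u ∘ cellMap (List.ofFn w)) (v ∘ cellMap (List.ofFn w))

/-- `E(u) = lim E_m(u, u)` is finite. The graph energies `E_m(u, u)` increase with `m`, so that
this means that they are bounded. -/
def FiniteEnergy (u : Plane → ℝ) : Prop :=
  BddAbove (range fun m : ℕ => graphEnergy m u u)

/-- Test functions on `U`: the functions in `dom E` (continuous on the gasket and of finite energy)
that vanish outside a compact subset of `U`. -/
structure IsTestFunction (U : Set Plane) (v : Plane → ℝ) : Prop where
  continuousOn : ContinuousOn v SG
  finiteEnergy : FiniteEnergy v
  compact_support : ∃ K : Set Plane, IsCompact K ∧ K ⊆ U ∧ ∀ x ∈ SG \ K, v x = 0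

/-- `Δ u = 0` in a (relatively open) subset `U` of the gasket, in the weak sense: `u` has finite
energy on each cell `F_w SG` that lies in `U`, and `E(u, v) = lim E_m(u, v)` is zero for all test
functions `v` on `U`. -/
structure IsHarmonicIn (U : Set Plane) (u : Plane → ℝ) : Prop where
  finiteEnergy : ∀ w : List (Fin 3), cellMap w '' SG ⊆ U → FiniteEnergy (u ∘ cellMap w)
  weak : ∀ v : Plane → ℝ, IsTestFunction U v →
    Tendsto (fun m : ℕ => graphEnergy m u v) atTop (𝓝 0)

/-- The half domain `Ω`: the points of the gasket strictly to the left of the vertical symmetry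
line through `q 0`, without the vertex `q 1`. -/
def halfDomain : Set Plane := {x | x ∈ SG ∧ x 0 < 1 / 2 ∧ x ≠ q 1}

/-- The part `X` of the boundary of `Ω` on the symmetry line. -/
def cutSet : Set Plane := {x | x ∈ SG ∧ x 0 = 1 / 2}

/-- The boundary `∂Ω = {q 1} ∪ X`. -/
def halfBoundary : Set Plane := {q 1} ∪ cutSet

/-- The vertex `q 1`, as a point of `∂Ω`. -/
def leftVertex : halfBoundary := ⟨q 1, Or.inl rfl⟩

/-- `u` solves the Dirichlet problem `Δ u = 0` in `Ω`, `u = f` on `∂Ω`; it is continuous on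
the closure `Ω ∪ ∂Ω` of `Ω`. The values of `u` outside `Ω ∪ ∂Ω` play no role. -/
structure IsDirichletSolution (f : C(halfBoundary, ℝ)) (u : Plane → ℝ) : Prop where
  continuousOn : ContinuousOn u (halfDomain ∪ halfBoundary)
  harmonic : IsHarmonicIn halfDomain u
  boundary : ∀ x : halfBoundary, u x = f x

/-- The normal derivative of `u` at the vertex `F_w q_i` with respect to the cell `F_w SG` exists
and equals `d`, that is,
`d = r^{-|w|} lim_m r⁻ᵐ (2 (u ∘ F_w) (q_i) - (u ∘ F_w) (F_iᵐ q_{i+1}) - (u ∘ F_w) (F_iᵐ q_{i-1}))`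
with cyclic indices. -/
def HasNormalDeriv (u : Plane → ℝ) (w : List (Fin 3)) (i : Fin 3) (d : ℝ) : Prop :=
  Tendsto (fun m : ℕ => (r⁻¹) ^ w.length * ((r⁻¹) ^ m *
      (2 * u (cellMap w (q i)) - u (cellMap w ((F i)^[m] (q (i + 1))))
        - u (cellMap w ((F i)^[m] (q (i - 1)))))))
    atTop (𝓝 d)

/-- The word `0ᵏ1`. The point `p_k = F_0ᵏ F_1 q_2` of `X` is the right vertex of the cell
`F_0ᵏ F_1 SG`, which lies in `Ω ∪ ∂Ω`. -/
def pWord (k : ℕ) : List (Fin 3) := List.replicate k 0 ++ [1]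

/-- The series `∑ₖ aₖ` of real numbers converges (possibly only conditionally). -/
def SeriesConverges (a : ℕ → ℝ) : Prop :=
  ∃ s : ℝ, Tendsto (fun n : ℕ => ∑ k ∈ Finset.range n, a k) atTop (𝓝 s)

theorem continuous_F (i : Fin 3) : Continuous (F i) := by
  unfold F; fun_prop

theorem continuous_cellMap (w : List (Fin 3)) : Continuous (cellMap w) := by
  induction w with
  | nil => exact continuous_id
  | cons i w ih => exact (continuous_F i).comp ih

theorem F_q (i : Fin 3) : F i (q i) = q i := by
  unfold F
  rw [← two_smul ℝ (q i), smul_smul]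
  norm_num

theorem dist_F (i : Fin 3) (x y : Plane) : dist (F i x) (F i y) = (1 / 2) * dist x y := by
  unfold F
  rw [dist_smul₀, dist_add_right]
  norm_num

theorem dist_cellMap (w : List (Fin 3)) (x y : Plane) :
    dist (cellMap w x) (cellMap w y) = (1 / 2) ^ w.length * dist x y := by
  induction w with
  | nil => simp [cellMap]
  | cons i w ih => simp only [cellMap, Function.comp, dist_F, ih, List.length_cons]; ring

theorem vertices_eq : vertices = ⋃ i, F i '' vertices := by
  ext x
  simp only [mem_iUnion, mem_image]
  constructor
  · rintro ⟨w, j, rfl⟩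
    cases w with
    | nil => exact ⟨j, q j, ⟨[], j, rfl⟩, F_q j⟩
    | cons i w => exact ⟨i, _, ⟨w, j, rfl⟩, rfl⟩
  · rintro ⟨i, y, ⟨w, j, rfl⟩, rfl⟩
    exact ⟨i :: w, j, rfl⟩

theorem norm_le_of_mem_vertices {x : Plane} (hx : x ∈ vertices) :
    ‖x‖ ≤ ∑ i, ‖q i‖ := by
  have hq : ∀ i, ‖q i‖ ≤ ∑ j, ‖q j‖ := fun i =>
    Finset.single_le_sum (f := fun j => ‖q j‖) (fun j _ => norm_nonneg (q j)) (Finset.mem_univ i)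
  obtain ⟨w, j, rfl⟩ := hx
  induction w with
  | nil => exact hq j
  | cons i w ih =>
    simp only [cellMap, Function.comp, F, norm_smul]
    have h1 := norm_add_le (cellMap w (q j)) (q i)
    have h2 := hq i
    norm_num
    linarith

theorem isCompact_SG : IsCompact SG := by
  apply Metric.isCompact_of_isClosed_isBounded isClosed_closure
  refine Bornology.IsBounded.closure ?_
  exact isBounded_iff_forall_norm_le.2 ⟨_, fun x hx => norm_le_of_mem_vertices hx⟩

theorem SG_nonempty : SG.Nonempty := ⟨q 0, subset_closure ⟨[], 0, rfl⟩⟩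

theorem SG_eq_iUnion : SG = ⋃ i, F i '' SG := by
  have h : ∀ i, F i '' SG = closure (F i '' vertices) := fun i =>
    image_closure_of_isCompact isCompact_SG (continuous_F i).continuousOn
  simp only [h]
  rw [← closure_iUnion_of_finite, ← vertices_eq, SG]

theorem SG_unique (K : Set Plane) (hK : IsCompact K) (hne : K.Nonempty)
    (hF : K = ⋃ i, F i '' K) : K = SG := by
  have hmap : ∀ i, ∀ x ∈ K, F i x ∈ K := fun i x hx => by
    rw [hF]; exact mem_iUnion.2 ⟨i, x, hx, rfl⟩
  obtain ⟨x₀, hx₀⟩ := hne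
  have hit : ∀ i (n : ℕ), (F i)^[n] x₀ ∈ K := fun i n => by
    induction n with
    | zero => exact hx₀
    | succ n ih => rw [Function.iterate_succ_apply']; exact hmap i _ ih
  have hd : ∀ i (n : ℕ), dist ((F i)^[n] x₀) (q i) = (1 / 2) ^ n * dist x₀ (q i) := fun i n => by
    induction n with
    | zero => simp
    | succ n ih =>
      rw [Function.iterate_succ_apply']
      conv_lhs => rw [← F_q i]
      rw [dist_F, ih]; ring
  have hz : ∀ c : ℝ, Tendsto (fun n : ℕ => (1 / 2 : ℝ) ^ n * c) atTop (𝓝 0) := fun c => by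
    simpa using (tendsto_pow_atTop_nhds_zero_of_lt_one (r := (1 / 2 : ℝ)) (by norm_num)
      (by norm_num)).mul_const c
  have hq : ∀ i, q i ∈ K := fun i => by
    refine hK.isClosed.mem_of_tendsto (f := fun n : ℕ => (F i)^[n] x₀) (b := atTop) ?_
      (Eventually.of_forall (hit i))
    rw [tendsto_iff_dist_tendsto_zero]
    simpa only [hd] using hz (dist x₀ (q i))
  apply Subset.antisymm
  · have key : ∀ (n : ℕ), ∀ x ∈ K, ∃ w : List (Fin 3), w.length = n ∧ ∃ y ∈ K,
        x = cellMap w y := by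
      intro n
      induction n with
      | zero => exact fun x hx => ⟨[], rfl, x, hx, rfl⟩
      | succ n ih =>
        intro x hx
        rw [hF] at hx
        obtain ⟨i, y, hy, rfl⟩ := mem_iUnion.1 hx
        obtain ⟨w, hw, z, hz, rfl⟩ := ih y hy
        exact ⟨i :: w, by simp [hw], z, hz, rfl⟩
    intro x hx
    obtain ⟨C, hC⟩ := Metric.isBounded_iff.1 hK.isBounded
    refine Metric.mem_closure_iff.2 fun ε hε => ?_
    obtain ⟨n, hn⟩ := ((hz C).eventually (gt_mem_nhds hε)).exists
    obtain ⟨w, hw, y, hy, rfl⟩ := key n x hx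
    refine ⟨cellMap w (q 0), ⟨w, 0, rfl⟩, ?_⟩
    rw [dist_cellMap, hw]
    exact lt_of_le_of_lt (mul_le_mul_of_nonneg_left (hC hy (hq 0)) (by positivity)) hn
  · refine closure_minimal ?_ hK.isClosed
    rintro x ⟨w, j, rfl⟩
    induction w with
    | nil => exact hq j
    | cons i w ih => exact hmap i _ ih

end SierpinskiHalf

end

/-!
The half domain is a chain of copies `F_0ᵏ F_1 SG`, `k ≥ 0`, of the gasket that accumulates at
`q 0`. The cell number `k` has the corners `a_k = F_0ᵏ q_1`, `a_{k+1}` and `p_k`; two consecutive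
cells share the vertex `a_{k+1}`, and the boundary of the half domain consists of `a_0 = q_1`, the
points `p_k` and `q 0`. A solution is determined by its values `u_k` at `a_k` and `f_k` at `p_k`:

* On each cell it is harmonic (`vertexHarmonic_comp_pWord`), so that its vertex values follow the
  `1/5`-`2/5` rule. Weak harmonicity only gives the discrete equation away from the corners of the
  cell, but the corners are removable for a continuous function by the maximum principle
  (`vertexHarmonic_of_graphEnergy_eq_zero`).
* At `a_{k+1}` the two normal derivatives add up to zero (`matching`):
  `(3/5) B_k + A_{k+1} = 0` with `A_k = 2 u_k - u_{k+1} - f_k` and `B_k = 2 u_{k+1} - u_k - f_k`.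

Conversely these two properties imply weak harmonicity (`isHarmonicIn_of_matching`). By the scaling
of harmonic functions at a corner, the normal derivative at `p_k` is
`(5/3)^(k+1) (2 f_k - u_k - u_{k+1}) = -(5/3)^(k+1) (A_k + B_k)`.

The rest is about sequences. Continuity at `q 0` says that `u_k` and `f_k` have the same limit;
since `A_k + B_k` is a telescoping expression under the matching conditions, the series converges
(`seriesConverges_of_matching`). In the other direction, the recursion
`A_{k+1} = (3/5) (A_k + η_k)` determines `u_k` and `f_k` from the normal derivatives, and they
converge to the same limit if `∑ η_k` converges (`exists_chain_values`, `chain_values_unique`). The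
function with these values is obtained from its vertex values by
`exists_continuousOn_of_compatible`, which also provides the harmonic splines that serve as test
functions (`exists_spline`).
-/

noncomputable section

namespace SierpinskiHalf

/-! ### Barycentric coordinates and the intersection pattern of cells -/

/-- The barycentric coordinates of a point of the plane with respect to `q 0`, `q 1`, `q 2`. -/
def bary (i : Fin 3) (x : Plane) : ℝ :=
  ![2 * x 1 / Real.sqrt 3, 1 - x 0 - x 1 / Real.sqrt 3, x 0 - x 1 / Real.sqrt 3] i

theorem bary_q (i j : Fin 3) : bary i (q j) = if i = j then 1 else 0 := by
  have h : Real.sqrt 3 ≠ 0 := by positivity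
  fin_cases i <;> fin_cases j <;> simp [bary, q] <;> field_simp <;> norm_num

theorem bary_F (i j : Fin 3) (x : Plane) :
    bary j (F i x) = (bary j x + if j = i then 1 else 0) / 2 := by
  have h : Real.sqrt 3 ≠ 0 := by positivity
  fin_cases i <;> fin_cases j <;> simp [bary, F, q] <;> field_simp <;> ring

theorem sum_bary (x : Plane) : bary 0 x + bary 1 x + bary 2 x = 1 := by
  simp [bary]; ring

theorem bary_ext {x y : Plane} (h : ∀ i, bary i x = bary i y) : x = y := by
  have hs : Real.sqrt 3 ≠ 0 := by positivity
  have h0 := h 0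
  have h2 := h 2
  simp only [bary, Matrix.cons_val] at h0 h2
  have h1 : x 1 = y 1 := by field_simp at h0; linarith
  rw [h1] at h2
  ext i
  fin_cases i
  · simp only [Fin.zero_eta]; linarith
  · exact h1

theorem continuous_bary (i : Fin 3) : Continuous (bary i) := by
  have h0 : Continuous fun x : Plane => 2 * x 1 / Real.sqrt 3 := by fun_prop
  have h1 : Continuous fun x : Plane => 1 - x 0 - x 1 / Real.sqrt 3 := by fun_prop
  have h2 : Continuous fun x : Plane => x 0 - x 1 / Real.sqrt 3 := by fun_prop
  fin_cases i
  · exact h0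
  · exact h1
  · exact h2

theorem bary_two_sub_bary_one (x : Plane) : bary 2 x - bary 1 x = 2 * x 0 - 1 := by
  simp [bary]; ring

theorem bary_nonneg {x : Plane} (hx : x ∈ SG) (i : Fin 3) : 0 ≤ bary i x := by
  have hcl : IsClosed {x | 0 ≤ bary i x} := isClosed_le continuous_const (continuous_bary i)
  refine closure_minimal ?_ hcl hx
  rintro _ ⟨w, j, rfl⟩
  induction w with
  | nil => simp only [cellMap, id, mem_ofPred_eq, bary_q]; split_ifs <;> norm_num
  | cons k w ih =>
    simp only [cellMap, Function.comp, mem_ofPred_eq, bary_F] at ih ⊢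
    split_ifs <;> linarith

theorem bary_le_one {x : Plane} (hx : x ∈ SG) (i : Fin 3) : bary i x ≤ 1 := by
  have h := sum_bary x
  have h0 := bary_nonneg hx 0
  have h1 := bary_nonneg hx 1
  have h2 := bary_nonneg hx 2
  fin_cases i <;> simp only [Fin.reduceFinMk, Fin.zero_eta, Fin.mk_one] <;> linarith

theorem eq_q_of_bary_eq_one {x : Plane} (hx : x ∈ SG) {i : Fin 3} (h : bary i x = 1) :
    x = q i := by
  have hs := sum_bary x
  have h0 := bary_nonneg hx 0
  have h1 := bary_nonneg hx 1
  have h2 := bary_nonneg hx 2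
  refine bary_ext fun j => ?_
  rw [bary_q]
  fin_cases i <;> fin_cases j <;>
    simp only [Fin.reduceFinMk, Fin.zero_eta, Fin.mk_one, Fin.reduceEq, if_true, if_false] at h ⊢ <;>
    linarith

theorem injective_F (i : Fin 3) : Function.Injective (F i) := fun x y h => by
  have := dist_F i x y
  rw [h, dist_self] at this
  exact dist_eq_zero.1 (by linarith)

theorem F_q_comm (i j : Fin 3) : F i (q j) = F j (q i) := by
  simp only [F, add_comm]

theorem cellMap_append (w w' : List (Fin 3)) (x : Plane) :
    cellMap (w ++ w') x = cellMap w (cellMap w' x) := by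
  induction w with
  | nil => rfl
  | cons i w ih => simp only [List.cons_append, cellMap, Function.comp, ih]

theorem cellMap_replicate_q (n : ℕ) (i : Fin 3) : cellMap (List.replicate n i) (q i) = q i := by
  induction n with
  | zero => rfl
  | succ n ih => simp only [List.replicate_succ, cellMap, Function.comp, ih, F_q]

theorem F_mem_SG (i : Fin 3) {x : Plane} (hx : x ∈ SG) : F i x ∈ SG := by
  rw [SG_eq_iUnion]; exact mem_iUnion.2 ⟨i, x, hx, rfl⟩

theorem cellMap_mem_SG (w : List (Fin 3)) {x : Plane} (hx : x ∈ SG) : cellMap w x ∈ SG := by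
  induction w with
  | nil => exact hx
  | cons i w ih => exact F_mem_SG i ih

theorem q_mem_SG (i : Fin 3) : q i ∈ SG := subset_closure ⟨[], i, rfl⟩

theorem exists_cell (n : ℕ) {x : Plane} (hx : x ∈ SG) :
    ∃ w : List (Fin 3), w.length = n ∧ ∃ y ∈ SG, cellMap w y = x := by
  induction n generalizing x with
  | zero => exact ⟨[], rfl, x, hx, rfl⟩
  | succ n ih =>
    rw [SG_eq_iUnion] at hx
    obtain ⟨i, y, hy, rfl⟩ := mem_iUnion.1 hx
    obtain ⟨w, hw, z, hz, rfl⟩ := ih hy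
    exact ⟨i :: w, by simp [hw], z, hz, rfl⟩

/-- The only cell of a given level that contains the vertex `q j` is `F_j^m SG`, and it contains
`q j` as its vertex with index `j`. -/
theorem eq_replicate_of_cellMap_eq_q {w : List (Fin 3)} {x : Plane} (hx : x ∈ SG) {j : Fin 3}
    (h : cellMap w x = q j) : w = List.replicate w.length j ∧ x = q j := by
  induction w with
  | nil => exact ⟨rfl, h⟩
  | cons i w ih =>
    have hb : bary j (F i (cellMap w x)) = 1 := by
      rw [show F i (cellMap w x) = q j from h, bary_q, if_pos rfl]
    have hm := cellMap_mem_SG w hx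
    have h1 := bary_le_one hm j
    rw [bary_F] at hb
    split_ifs at hb with hij
    · subst hij
      obtain ⟨h2, h3⟩ := ih (eq_q_of_bary_eq_one hm (by linarith))
      exact ⟨by rw [List.length_cons, List.replicate_succ, ← h2], h3⟩
    · linarith

/-- Two different cells of level one meet only in their common vertex. -/
theorem eq_q_of_F_eq {i j : Fin 3} (hij : i ≠ j) {x y : Plane} (hx : x ∈ SG) (hy : y ∈ SG)
    (h : F i x = F j y) : x = q j ∧ y = q i := by
  have key : ∀ {i j : Fin 3} {x y : Plane}, i ≠ j → x ∈ SG → y ∈ SG → F i x = F j y → x = q j := by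
    intro i j x y hij hx hy h
    have hb := congrArg (bary j) h
    rw [bary_F, bary_F, if_neg hij.symm, if_pos rfl] at hb
    have h1 := bary_le_one hx j
    have h2 := bary_nonneg hy j
    exact eq_q_of_bary_eq_one hx (by linarith)
  exact ⟨key hij hx hy h, key hij.symm hy hx h.symm⟩

/-- Two different cells of the same level meet only in common vertices. -/
theorem eq_or_vertices_of_cellMap_eq {w w' : List (Fin 3)} (hl : w.length = w'.length)
    {x y : Plane} (hx : x ∈ SG) (hy : y ∈ SG) (h : cellMap w x = cellMap w' y) :
    w = w' ∨ ∃ i j, x = q i ∧ y = q j := by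
  induction w generalizing w' with
  | nil =>
    rw [List.length_nil, eq_comm, List.length_eq_zero_iff] at hl
    exact Or.inl hl.symm
  | cons i w ih =>
    cases w' with
    | nil => simp at hl
    | cons j w' =>
      by_cases hij : i = j
      · subst hij
        rcases ih (by simpa using hl) (injective_F i h) with h1 | h1
        · exact Or.inl (by rw [h1])
        · exact Or.inr h1
      · obtain ⟨h1, h2⟩ := eq_q_of_F_eq hij (cellMap_mem_SG w hx) (cellMap_mem_SG w' hy) h
        exact Or.inr ⟨j, i, (eq_replicate_of_cellMap_eq_q hx h1).2,
          (eq_replicate_of_cellMap_eq_q hy h2).2⟩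

theorem exists_ofFn_eq {m : ℕ} {w : List (Fin 3)} (h : w.length = m) :
    ∃ k : Fin m → Fin 3, List.ofFn k = w := by
  subst h
  exact ⟨w.get, List.ofFn_get w⟩

theorem vertex_level {x : Plane} (hx : x ∈ vertices) :
    ∃ n, ∀ m, n ≤ m → ∃ (w : List (Fin 3)) (i : Fin 3), w.length = m ∧ cellMap w (q i) = x := by
  obtain ⟨w, i, rfl⟩ := hx
  refine ⟨w.length, fun m hm => ⟨w ++ List.replicate (m - w.length) i, i, by simp; omega, ?_⟩⟩
  rw [cellMap_append, cellMap_replicate_q]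

theorem eqOn_SG {u v : Plane → ℝ} (hu : ContinuousOn u SG) (hv : ContinuousOn v SG)
    (h : ∀ w i, u (cellMap w (q i)) = v (cellMap w (q i))) {x : Plane} (hx : x ∈ SG) :
    u x = v x := by
  have : EqOn u v SG := EqOn.of_subset_closure (s := vertices)
    (by rintro _ ⟨w, i, rfl⟩; exact h w i) hu hv subset_closure subset_rfl
  exact this hx

/-! ### Continuous functions with prescribed vertex values -/

/-- A family `t` of vertex values for all cells, `t w i` being meant for the point `F_w q_i`, is
compatible if it respects the coincidences `F_w F_i q_i = F_w q_i` and
`F_w F_i q_j = F_w F_j q_i`. -/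
structure Compatible (t : List (Fin 3) → Fin 3 → ℝ) : Prop where
  fixed : ∀ w i, t (w ++ [i]) i = t w i
  shared : ∀ w i j, t (w ++ [i]) j = t (w ++ [j]) i

theorem Compatible.of_cons {t : List (Fin 3) → Fin 3 → ℝ}
    (h : ∀ i, Compatible fun w => t (i :: w)) (h₁ : ∀ i, t [i] i = t [] i)
    (h₂ : ∀ i j, t [i] j = t [j] i) : Compatible t where
  fixed w i := by
    cases w with
    | nil => exact h₁ i
    | cons k w => exact (h k).fixed w i
  shared w i j := by
    cases w with
    | nil => exact h₂ i j
    | cons k w => exact (h k).shared w i j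

theorem Compatible.cons {t : List (Fin 3) → Fin 3 → ℝ} (h : Compatible t) (i : Fin 3) :
    Compatible fun w => t (i :: w) where
  fixed w j := h.fixed (i :: w) j
  shared w j k := h.shared (i :: w) j k

theorem Compatible.append_replicate {t : List (Fin 3) → Fin 3 → ℝ} (h : Compatible t)
    (w : List (Fin 3)) (i : Fin 3) (n : ℕ) : t (w ++ List.replicate n i) i = t w i := by
  induction n with
  | zero => simp
  | succ n ih => rw [List.replicate_succ', ← List.append_assoc, h.fixed, ih]

theorem Compatible.eq_of_length_eq {t : List (Fin 3) → Fin 3 → ℝ} (h : Compatible t)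
    {w w' : List (Fin 3)} (hl : w.length = w'.length) {i j : Fin 3}
    (hx : cellMap w (q i) = cellMap w' (q j)) : t w i = t w' j := by
  induction w generalizing w' t with
  | nil =>
    rw [List.length_nil, eq_comm, List.length_eq_zero_iff] at hl
    subst hl
    rw [(eq_replicate_of_cellMap_eq_q (w := []) (q_mem_SG i) rfl).2] at hx
    have hb := congrArg (bary j) hx
    simp only [cellMap, id, bary_q] at hb
    by_cases hji : j = i
    · rw [hji]
    · simp [hji] at hb
  | cons a w ih =>
    cases w' with
    | nil => simp at hl
    | cons b w' =>
      have hl' : w.length = w'.length := by simpa using hl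
      by_cases hab : a = b
      · subst hab
        exact ih (h.cons a) hl' (injective_F a hx)
      · obtain ⟨h1, h2⟩ := eq_q_of_F_eq hab (cellMap_mem_SG w (q_mem_SG i))
          (cellMap_mem_SG w' (q_mem_SG j)) hx
        have q_inj : ∀ {k l : Fin 3}, q k = q l → k = l := fun {k l} hkl => by
          have hb := congrArg (bary k) hkl
          by_contra hne
          simp [bary_q, hne] at hb
        obtain ⟨h3, h4⟩ := eq_replicate_of_cellMap_eq_q (q_mem_SG i) h1
        obtain ⟨h5, h6⟩ := eq_replicate_of_cellMap_eq_q (q_mem_SG j) h2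
        rw [q_inj h4, q_inj h6, h3, h5]
        have e1 := h.append_replicate [a] b w.length
        have e2 := h.append_replicate [b] a w'.length
        simp only [List.singleton_append] at e1 e2
        rw [e1, e2]
        exact h.shared [] a b

/-- Compatible values depend only on the vertex, not on the cell used to address it. -/
theorem Compatible.eq_of_cellMap_eq {t : List (Fin 3) → Fin 3 → ℝ} (h : Compatible t)
    {w w' : List (Fin 3)} {i j : Fin 3} (hx : cellMap w (q i) = cellMap w' (q j)) :
    t w i = t w' j := by
  rw [← h.append_replicate w i w'.length, ← h.append_replicate w' j w.length]
  refine h.eq_of_length_eq (by simp [add_comm]) ?_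
  simpa only [cellMap_append, cellMap_replicate_q] using hx

/-- On every cell of sufficiently high level, the prescribed values at all vertices inside the cell
differ from those at its corners by at most `ε`. -/
def SmallOsc (ε : ℝ) (t : List (Fin 3) → Fin 3 → ℝ) : Prop :=
  ∃ m, ∀ w : List (Fin 3), m ≤ w.length → ∀ w' i j, |t (w ++ w') j - t w i| ≤ ε

theorem SmallOsc.of_cons {ε : ℝ} {t : List (Fin 3) → Fin 3 → ℝ}
    (h : ∀ i, SmallOsc ε fun w => t (i :: w)) : SmallOsc ε t := by
  choose m hm using h
  refine ⟨(∑ i, m i) + 1, fun w hw => ?_⟩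
  cases w with
  | nil => simp at hw
  | cons i w =>
    have := Finset.single_le_sum (f := m) (fun _ _ => Nat.zero_le _) (Finset.mem_univ i)
    simp only [List.length_cons] at hw
    exact hm i w (by omega)

/-- Compatible vertex values whose oscillation on the cells tends to zero are the vertex values of
a continuous function on the gasket. Near a point `x`, only the cells of level `m` that contain `x`
matter, and two of them share `x` as a vertex. -/
theorem exists_continuousOn_of_compatible {t : List (Fin 3) → Fin 3 → ℝ} (hc : Compatible t)
    (ho : ∀ ε > 0, SmallOsc ε t) :
    ∃ u : Plane → ℝ, ContinuousOn u SG ∧ ∀ w i, u (cellMap w (q i)) = t w i := by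
  classical
  have hex : ∃ φ : Plane → ℝ, ∀ w i, φ (cellMap w (q i)) = t w i := by
    refine ⟨fun x => if h : ∃ p : List (Fin 3) × Fin 3, cellMap p.1 (q p.2) = x then
      t h.choose.1 h.choose.2 else 0, fun w i => ?_⟩
    have h : ∃ p : List (Fin 3) × Fin 3, cellMap p.1 (q p.2) = cellMap w (q i) := ⟨(w, i), rfl⟩
    simp only [dif_pos h]
    exact hc.eq_of_cellMap_eq h.choose_spec
  obtain ⟨φ, hφ⟩ := hex
  have hlim : ∀ x ∈ SG, ∃ y, Tendsto φ (𝓝[vertices] x) (𝓝 y) := by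
    intro x hx
    have : (𝓝[vertices] x).NeBot := mem_closure_iff_nhdsWithin_neBot.1 hx
    refine cauchy_map_iff_exists_tendsto.1 ?_
    refine Metric.cauchy_iff.2 ⟨inferInstance, fun ε hε => ?_⟩
    obtain ⟨m, hm⟩ := ho (ε / 3) (by positivity)
    set C : Set Plane := ⋃ w ∈ {w : Fin m → Fin 3 | x ∉ cellMap (List.ofFn w) '' SG},
      cellMap (List.ofFn w) '' SG with hC
    have hCc : IsClosed C := (toFinite _).isClosed_biUnion fun w _ =>
      (isCompact_SG.image (continuous_cellMap _)).isClosed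
    have hxC : x ∉ C := by
      simp only [hC, mem_iUnion, not_exists]
      exact fun w hw hx => hw hx
    -- a vertex outside `C` lies in a cell of level `m` that also contains `x`
    have hcell : ∀ y ∈ vertices, y ∉ C → ∃ w w' : List (Fin 3), ∃ j, w.length = m ∧
        y = cellMap (w ++ w') (q j) ∧ ∃ z ∈ SG, cellMap w z = x := by
      rintro y hy hyC
      obtain ⟨n, hn⟩ := vertex_level hy
      obtain ⟨w, i, hw, rfl⟩ := hn (n + m) (by omega)
      refine ⟨w.take m, w.drop m, i, by simp; omega, by rw [List.take_append_drop], ?_⟩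
      by_contra hne
      obtain ⟨k, hk⟩ := exists_ofFn_eq (w := w.take m) (m := m) (by simp; omega)
      refine hyC (mem_biUnion (x := k) ?_ ?_)
      · rw [mem_ofPred_eq, hk]
        rintro ⟨z, hz, hzx⟩
        exact hne ⟨z, hz, hzx⟩
      · rw [hk]
        refine ⟨cellMap (w.drop m) (q i), cellMap_mem_SG _ (q_mem_SG i), ?_⟩
        rw [← cellMap_append, List.take_append_drop]
    refine ⟨φ '' (Cᶜ ∩ vertices), image_mem_map ?_, ?_⟩
    · exact inter_mem (mem_nhdsWithin_of_mem_nhds (hCc.isOpen_compl.mem_nhds hxC))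
        self_mem_nhdsWithin
    rintro _ ⟨y, ⟨hyC, hy⟩, rfl⟩ _ ⟨z, ⟨hzC, hz⟩, rfl⟩
    obtain ⟨w, w', j, hw, rfl, a, ha, hax⟩ := hcell y hy hyC
    obtain ⟨v, v', k, hv, rfl, b, hb, hbx⟩ := hcell z hz hzC
    rw [hφ, hφ, Real.dist_eq]
    rcases eq_or_vertices_of_cellMap_eq (hw.trans hv.symm) ha hb (hax.trans hbx.symm) with
      rfl | ⟨i, l, rfl, rfl⟩
    · have h1 := abs_le.1 (hm w hw.ge w' 0 j)
      have h2 := abs_le.1 (hm w hw.ge v' 0 k)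
      exact abs_lt.2 ⟨by linarith, by linarith⟩
    · have h1 := abs_le.1 (hm w hw.ge w' i j)
      have h2 := abs_le.1 (hm v hv.ge v' l k)
      have h3 := hc.eq_of_cellMap_eq (hax.trans hbx.symm)
      exact abs_lt.2 ⟨by linarith, by linarith⟩
  refine ⟨extendFrom vertices φ, continuousOn_extendFrom subset_rfl hlim, fun w i => ?_⟩
  have hv : cellMap w (q i) ∈ vertices := ⟨w, i, rfl⟩
  obtain ⟨y, hy⟩ := hlim _ (subset_closure hv)
  rw [extendFrom_eq (subset_closure hv) hy, ← hφ]
  exact (tendsto_nhds_unique (tendsto_pure_nhds φ _)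
    (hy.mono_left (pure_le_nhdsWithin hv))).symm

/-! ### The harmonic extension rule -/

/-- The corner values on the cell `F_i SG` of the harmonic function with corner values `b` on the
gasket: this is the `1/5`-`2/5` rule, `(2 b i + 2 b j + b k) / 5` at the midpoint `F_i q_j`. -/
def harmStep (i : Fin 3) (b : Fin 3 → ℝ) (j : Fin 3) : ℝ :=
  if j = i then b i else (b 0 + b 1 + b 2 + b i + b j) / 5

/-- The vertex values of the harmonic function with corner values `b`. -/
def harmTree : (Fin 3 → ℝ) → List (Fin 3) → Fin 3 → ℝ
  | b, [] => b
  | b, i :: w => harmTree (harmStep i b) w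

/-- The `1/5`-`2/5` rule holds in every cell of the gasket. -/
def VertexHarmonic (u : Plane → ℝ) : Prop :=
  ∀ w i j, u (cellMap w (F i (q j))) = harmStep i (fun l => u (cellMap w (q l))) j

theorem harmTree_append (b : Fin 3 → ℝ) (w w' : List (Fin 3)) :
    harmTree b (w ++ w') = harmTree (harmTree b w) w' := by
  induction w generalizing b with
  | nil => rfl
  | cons i w ih => exact ih _

theorem compatible_harmTree (b : Fin 3 → ℝ) : Compatible (harmTree b) where
  fixed w i := by rw [harmTree_append]; simp [harmTree, harmStep]
  shared w i j := by
    rw [harmTree_append, harmTree_append]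
    simp only [harmTree, harmStep, eq_comm (a := i) (b := j)]
    split_ifs with h
    · rw [h]
    · ring

theorem le_harmTree {b : Fin 3 → ℝ} {c : ℝ} (h : ∀ i, c ≤ b i) (w : List (Fin 3)) (i : Fin 3) :
    c ≤ harmTree b w i := by
  induction w generalizing b with
  | nil => exact h i
  | cons k w ih =>
    refine ih fun j => ?_
    simp only [harmStep]
    split_ifs
    · exact h k
    · linarith [h 0, h 1, h 2, h k, h j]

theorem harmTree_le {b : Fin 3 → ℝ} {c : ℝ} (h : ∀ i, b i ≤ c) (w : List (Fin 3)) (i : Fin 3) :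
    harmTree b w i ≤ c := by
  induction w generalizing b with
  | nil => exact h i
  | cons k w ih =>
    refine ih fun j => ?_
    simp only [harmStep]
    split_ifs
    · exact h k
    · linarith [h 0, h 1, h 2, h k, h j]

theorem sub_harmStep_le {b : Fin 3 → ℝ} {c : ℝ} (h : ∀ i j, b i - b j ≤ c) (k i j : Fin 3) :
    harmStep k b i - harmStep k b j ≤ 3 / 5 * c := by
  have h00 := h 0 0
  have h01 := h 0 1
  have h02 := h 0 2
  have h10 := h 1 0
  have h12 := h 1 2
  have h20 := h 2 0
  have h21 := h 2 1
  fin_cases k <;> fin_cases i <;> fin_cases j <;>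
    simp only [harmStep, Fin.reduceFinMk, Fin.zero_eta, Fin.mk_one, Fin.reduceEq, if_true,
      if_false] <;>
    linarith

theorem sub_harmTree_le {b : Fin 3 → ℝ} {c : ℝ} (h : ∀ i j, b i - b j ≤ c) (w : List (Fin 3))
    (i j : Fin 3) : harmTree b w i - harmTree b w j ≤ (3 / 5) ^ w.length * c := by
  induction w generalizing b c with
  | nil => simpa [harmTree] using h i j
  | cons k w ih =>
    refine (ih (sub_harmStep_le h k)).trans_eq ?_
    rw [List.length_cons]
    ring

theorem abs_harmTree_sub_le {b : Fin 3 → ℝ} {c : ℝ} (h : ∀ i j, b i - b j ≤ c)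
    (w : List (Fin 3)) (i j : Fin 3) : |harmTree b w j - b i| ≤ c := by
  have h1 := le_harmTree (b := b) (c := b i - c) (fun j => by linarith [h i j]) w j
  have h2 := harmTree_le (b := b) (c := b i + c) (fun j => by linarith [h j i]) w j
  exact abs_le.2 ⟨by linarith, by linarith⟩

theorem smallOsc_harmTree (b : Fin 3 → ℝ) {ε : ℝ} (hε : 0 < ε) : SmallOsc ε (harmTree b) := by
  set c := ∑ i, |b i| + ∑ i, |b i| with hc
  have hb : ∀ i j, b i - b j ≤ c := fun i j => by
    have h1 := Finset.single_le_sum (f := fun i => |b i|) (fun _ _ => abs_nonneg _)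
      (Finset.mem_univ i)
    have h2 := Finset.single_le_sum (f := fun i => |b i|) (fun _ _ => abs_nonneg _)
      (Finset.mem_univ j)
    have h3 := le_abs_self (b i)
    have h4 := neg_abs_le (b j)
    linarith
  have hc0 : 0 ≤ c := by positivity
  have ht : Tendsto (fun n : ℕ => (3 / 5 : ℝ) ^ n * c) atTop (𝓝 0) := by
    simpa using (tendsto_pow_atTop_nhds_zero_of_lt_one (r := (3 / 5 : ℝ)) (by norm_num)
      (by norm_num)).mul_const c
  obtain ⟨m, hm⟩ := (ht.eventually (gt_mem_nhds hε)).exists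
  refine ⟨m, fun w hw w' i j => ?_⟩
  rw [harmTree_append]
  refine (abs_harmTree_sub_le (sub_harmTree_le hb w) w' i j).trans (le_trans ?_ hm.le)
  exact mul_le_mul_of_nonneg_right
    (pow_le_pow_of_le_one (by norm_num) (by norm_num) hw) hc0

theorem vertexHarmonic_of_eq_harmTree {u : Plane → ℝ} {b : Fin 3 → ℝ}
    (h : ∀ w i, u (cellMap w (q i)) = harmTree b w i) : VertexHarmonic u := by
  intro w i j
  have e := h (w ++ [i]) j
  rw [cellMap_append, harmTree_append] at e
  rw [show F i (q j) = cellMap [i] (q j) from rfl, e]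
  simp only [h]
  rfl

namespace VertexHarmonic

variable {u : Plane → ℝ}

theorem eq_harmTree (hu : VertexHarmonic u) (w : List (Fin 3)) (i : Fin 3) :
    u (cellMap w (q i)) = harmTree (fun l => u (q l)) w i := by
  induction w using List.reverseRecOn generalizing i with
  | nil => rfl
  | append_singleton w k ih =>
    rw [cellMap_append, harmTree_append]
    have e : (fun l => u (cellMap w (q l))) = harmTree (fun l => u (q l)) w := funext ih
    exact (hu w k i).trans (by rw [e]; rfl)

theorem comp_cellMap (hu : VertexHarmonic u) (w : List (Fin 3)) :
    VertexHarmonic (u ∘ cellMap w) := by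
  intro w' i j
  simpa only [cellMap_append, Function.comp] using hu (w ++ w') i j

theorem comp_F (hu : VertexHarmonic u) (i : Fin 3) : VertexHarmonic (u ∘ F i) :=
  hu.comp_cellMap [i]

theorem eq_zero (hu : VertexHarmonic u) (h : ∀ i, u (q i) = 0) (w : List (Fin 3)) (i : Fin 3) :
    u (cellMap w (q i)) = 0 := by
  rw [hu.eq_harmTree]
  exact le_antisymm (harmTree_le (fun l => (h l).le) w i) (le_harmTree (fun l => (h l).ge) w i)

end VertexHarmonic

theorem exists_vertexHarmonic (b : Fin 3 → ℝ) :
    ∃ h : Plane → ℝ, ContinuousOn h SG ∧ VertexHarmonic h ∧ ∀ i, h (q i) = b i := by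
  obtain ⟨h, hc, hv⟩ := exists_continuousOn_of_compatible (compatible_harmTree b)
    fun ε hε => smallOsc_harmTree b hε
  exact ⟨h, hc, vertexHarmonic_of_eq_harmTree hv, fun i => hv [] i⟩

/-! ### Graph energies -/

theorem graphEnergy_zero (u v : Plane → ℝ) : graphEnergy 0 u v = energy₀ u v := by
  simp [graphEnergy, cellMap]

theorem graphEnergy_succ (m : ℕ) (u v : Plane → ℝ) :
    graphEnergy (m + 1) u v = r⁻¹ * ∑ i, graphEnergy m (u ∘ F i) (v ∘ F i) := by
  have h : ∑ w : Fin (m + 1) → Fin 3,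
        energy₀ (u ∘ cellMap (List.ofFn w)) (v ∘ cellMap (List.ofFn w)) =
      ∑ p : Fin 3 × (Fin m → Fin 3),
        energy₀ ((u ∘ F p.1) ∘ cellMap (List.ofFn p.2)) ((v ∘ F p.1) ∘ cellMap (List.ofFn p.2)) := by
    refine (Fintype.sum_equiv (Fin.consEquiv fun _ => Fin 3) _ _ fun p => ?_).symm
    simp only [Fin.consEquiv, Equiv.coe_fn_mk, List.ofFn_cons]
    rfl
  simp only [graphEnergy, h, Fintype.sum_prod_type, ← Finset.mul_sum]
  ring

theorem graphEnergy_congr {m : ℕ} {u u' v v' : Plane → ℝ}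
    (hu : ∀ w i, w.length = m → u (cellMap w (q i)) = u' (cellMap w (q i)))
    (hv : ∀ w i, w.length = m → v (cellMap w (q i)) = v' (cellMap w (q i))) :
    graphEnergy m u v = graphEnergy m u' v' := by
  unfold graphEnergy
  congr 1
  refine Finset.sum_congr rfl fun w _ => ?_
  have hl : (List.ofFn w).length = m := List.length_ofFn
  simp only [energy₀, Function.comp, hu _ _ hl, hv _ _ hl]

theorem graphEnergy_eq_zero {m : ℕ} {u v : Plane → ℝ}
    (hv : ∀ w i, w.length = m → v (cellMap w (q i)) = 0) : graphEnergy m u v = 0 := by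
  rw [graphEnergy_congr (u' := u) (v' := fun _ => 0) (fun _ _ _ => rfl) hv]
  simp [graphEnergy, energy₀]

theorem graphEnergy_comm (m : ℕ) (u v : Plane → ℝ) : graphEnergy m u v = graphEnergy m v u := by
  unfold graphEnergy
  congr 1
  refine Finset.sum_congr rfl fun w _ => ?_
  simp only [energy₀]
  ring

theorem graphEnergy_sub_left (m : ℕ) (u u' v : Plane → ℝ) :
    graphEnergy m (fun x => u x - u' x) v = graphEnergy m u v - graphEnergy m u' v := by
  unfold graphEnergy
  rw [← mul_sub, ← Finset.sum_sub_distrib]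
  congr 1
  refine Finset.sum_congr rfl fun w _ => ?_
  simp only [energy₀, Function.comp]
  ring

theorem graphEnergy_self_nonneg (m : ℕ) (u : Plane → ℝ) : 0 ≤ graphEnergy m u u := by
  refine mul_nonneg (pow_nonneg (by norm_num [r]) _) (Finset.sum_nonneg fun w _ => ?_)
  simp only [energy₀]
  nlinarith

/-- Passing from a cell to its three subcells does not change the energy pairing with a function
that satisfies the `1/5`-`2/5` rule. -/
theorem VertexHarmonic.graphEnergy_eq {u : Plane → ℝ} (hu : VertexHarmonic u) (m : ℕ)
    (v : Plane → ℝ) : graphEnergy m u v = energy₀ u v := by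
  induction m generalizing u v with
  | zero => exact graphEnergy_zero u v
  | succ m ih =>
    have e : ∀ i j, u (F i (q j)) = harmStep i (fun l => u (q l)) j := fun i j => hu [] i j
    rw [graphEnergy_succ, Finset.sum_congr rfl fun i _ => ih (hu.comp_F i) _]
    simp only [Fin.sum_univ_three, energy₀, Function.comp, e, harmStep, Fin.reduceEq, if_true,
      if_false, F_q, F_q_comm 1 0, F_q_comm 2 0, F_q_comm 2 1, r]
    ring

/-- The energy pairing with a function that is harmonic on the `m`-cells can be computed at
level `m`. -/
theorem graphEnergy_add_of_vertexHarmonic {m : ℕ} {v : Plane → ℝ}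
    (hv : ∀ w : List (Fin 3), w.length = m → VertexHarmonic (v ∘ cellMap w)) (n : ℕ)
    (u : Plane → ℝ) : graphEnergy (m + n) u v = graphEnergy m u v := by
  induction m generalizing u v with
  | zero =>
    have h : VertexHarmonic v := hv [] rfl
    rw [graphEnergy_comm, graphEnergy_comm 0, h.graphEnergy_eq, h.graphEnergy_eq]
  | succ m ih =>
    rw [Nat.succ_add, Nat.succ_eq_add_one, graphEnergy_succ, graphEnergy_succ]
    congr 1
    exact Finset.sum_congr rfl fun i _ => ih (fun w hw => hv (i :: w) (by simp [hw])) _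

theorem finiteEnergy_of_vertexHarmonic {m : ℕ} {v : Plane → ℝ}
    (hv : ∀ w : List (Fin 3), w.length = m → VertexHarmonic (v ∘ cellMap w)) :
    FiniteEnergy v := by
  refine Tendsto.bddAbove_range (a := graphEnergy m v v) ?_
  refine tendsto_const_nhds.congr' ?_
  filter_upwards [eventually_ge_atTop m] with n hn
  obtain ⟨k, rfl⟩ := Nat.exists_eq_add_of_le hn
  exact (graphEnergy_add_of_vertexHarmonic hv k v).symm

/-! ### Harmonic splines as test functions -/

/-- The vertex values of the spline that agrees with `φ` at the vertices of level `m` and is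
harmonic on the `m`-cells. -/
def splineTree : ℕ → (Plane → ℝ) → List (Fin 3) → Fin 3 → ℝ
  | 0, φ, w => harmTree (fun i => φ (q i)) w
  | _ + 1, φ, [] => fun i => φ (q i)
  | m + 1, φ, i :: w => splineTree m (φ ∘ F i) w

theorem splineTree_nil (m : ℕ) (φ : Plane → ℝ) (i : Fin 3) : splineTree m φ [] i = φ (q i) := by
  cases m <;> rfl

theorem compatible_splineTree (m : ℕ) (φ : Plane → ℝ) : Compatible (splineTree m φ) := by
  induction m generalizing φ with
  | zero => exact compatible_harmTree _
  | succ m ih =>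
    refine Compatible.of_cons (fun i => ih _) (fun i => ?_) (fun i j => ?_)
    · simp only [splineTree, splineTree_nil, Function.comp, F_q]
    · simp only [splineTree, splineTree_nil, Function.comp, F_q_comm i j]

theorem smallOsc_splineTree (m : ℕ) (φ : Plane → ℝ) {ε : ℝ} (hε : 0 < ε) :
    SmallOsc ε (splineTree m φ) := by
  induction m generalizing φ with
  | zero => exact smallOsc_harmTree _ hε
  | succ m ih => exact SmallOsc.of_cons fun i => ih _

theorem splineTree_append {m : ℕ} (φ : Plane → ℝ) {w : List (Fin 3)} (hw : w.length = m)
    (w' : List (Fin 3)) :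
    splineTree m φ (w ++ w') = harmTree (fun i => φ (cellMap w (q i))) w' := by
  induction w generalizing m φ with
  | nil => subst hw; rfl
  | cons i w ih =>
    subst hw
    exact ih (φ ∘ F i) rfl

theorem exists_spline (m : ℕ) (φ : Plane → ℝ) :
    ∃ v : Plane → ℝ, ContinuousOn v SG ∧
      (∀ w i, w.length = m → v (cellMap w (q i)) = φ (cellMap w (q i))) ∧
      ∀ w : List (Fin 3), w.length = m → VertexHarmonic (v ∘ cellMap w) := by
  obtain ⟨v, hc, hv⟩ := exists_continuousOn_of_compatible (compatible_splineTree m φ)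
    fun ε hε => smallOsc_splineTree m φ hε
  refine ⟨v, hc, fun w i hw => ?_, fun w hw => ?_⟩
  · have := splineTree_append φ hw []
    rw [List.append_nil] at this
    rw [hv, this]
    rfl
  · refine vertexHarmonic_of_eq_harmTree (b := fun i => φ (cellMap w (q i))) fun w' i => ?_
    rw [Function.comp, ← cellMap_append, hv, splineTree_append φ hw]

/-- A weakly harmonic function satisfies the discrete equation tested with any `φ` such that the
`m`-cells with a nonzero corner value of `φ` lie in the domain: the harmonic spline through `φ`
is a test function. -/
theorem IsHarmonicIn.graphEnergy_eq_zero {U : Set Plane} {u : Plane → ℝ} (hu : IsHarmonicIn U u)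
    (m : ℕ) (φ : Plane → ℝ)
    (hφ : ∀ w i, w.length = m → φ (cellMap w (q i)) ≠ 0 → cellMap w '' SG ⊆ U) :
    graphEnergy m u φ = 0 := by
  obtain ⟨v, hc, hv, hh⟩ := exists_spline m φ
  have htest : IsTestFunction U v := by
    refine ⟨hc, finiteEnergy_of_vertexHarmonic hh,
      ⋃ w ∈ {w : Fin m → Fin 3 | ∃ i, φ (cellMap (List.ofFn w) (q i)) ≠ 0},
        cellMap (List.ofFn w) '' SG, ?_, ?_, ?_⟩
    · exact (toFinite _).isCompact_biUnion fun w _ => isCompact_SG.image (continuous_cellMap _)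
    · refine iUnion₂_subset fun w hw => ?_
      obtain ⟨i, hi⟩ := hw
      exact hφ _ i List.length_ofFn hi
    · rintro x ⟨hx, hxK⟩
      obtain ⟨w, hw, y, hy, rfl⟩ := exists_cell m hx
      obtain ⟨k, rfl⟩ := exists_ofFn_eq hw
      have h0 : ∀ i, φ (cellMap (List.ofFn k) (q i)) = 0 := fun i => by
        by_contra hi
        exact hxK (mem_biUnion (x := k) ⟨i, hi⟩ ⟨y, hy, rfl⟩)
      have hz := (hh _ hw).eq_zero fun i => (hv _ i hw).trans (h0 i)
      refine eqOn_SG (u := v ∘ cellMap (List.ofFn k)) (v := fun _ => 0) ?_ continuousOn_const hz hy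
      exact hc.comp (continuous_cellMap _).continuousOn fun x hx => cellMap_mem_SG _ hx
  have hlim : Tendsto (fun n => graphEnergy n u v) atTop (𝓝 (graphEnergy m u φ)) := by
    refine tendsto_const_nhds.congr' ?_
    filter_upwards [eventually_ge_atTop m] with n hn
    obtain ⟨k, rfl⟩ := Nat.exists_eq_add_of_le hn
    rw [graphEnergy_add_of_vertexHarmonic hh k u]
    exact graphEnergy_congr (fun _ _ _ => rfl) fun w i hw => (hv w i hw).symm
  exact tendsto_nhds_unique hlim (hu.weak v htest)

/-! ### A maximum principle -/

theorem tendsto_cellMap_replicate {g : Plane → ℝ} {S : Set Plane} {x : Plane} {j : Fin 3}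
    (hc : ContinuousWithinAt g S (q j)) (hx : ∀ m, cellMap (List.replicate m j) x ∈ S) :
    Tendsto (fun m => g (cellMap (List.replicate m j) x)) atTop (𝓝 (g (q j))) := by
  refine hc.tendsto.comp (tendsto_nhdsWithin_iff.2 ⟨?_, Eventually.of_forall hx⟩)
  rw [tendsto_iff_dist_tendsto_zero]
  have h : ∀ m, dist (cellMap (List.replicate m j) x) (q j) = (1 / 2) ^ m * dist x (q j) :=
    fun m => by
      conv_lhs => rw [← cellMap_replicate_q m j]
      rw [dist_cellMap, List.length_replicate]
  simp only [h]
  simpa using (tendsto_pow_atTop_nhds_zero_of_lt_one (r := (1 / 2 : ℝ)) (by norm_num)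
    (by norm_num)).mul_const (dist x (q j))

/-- A function without energy of level `m` is constant on the vertices of level `m`. -/
theorem eq_of_graphEnergy_self_nonpos {m : ℕ} {ψ : Plane → ℝ} (h : graphEnergy m ψ ψ ≤ 0)
    (w : List (Fin 3)) (i : Fin 3) (hw : w.length = m) : ψ (cellMap w (q i)) = ψ (q 0) := by
  induction m generalizing ψ w i with
  | zero =>
    rw [List.length_eq_zero_iff] at hw
    subst hw
    rw [graphEnergy_zero, energy₀] at h
    have h1 : ψ (q 0) - ψ (q 1) = 0 := by nlinarith
    have h2 : ψ (q 2) - ψ (q 0) = 0 := by nlinarith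
    fin_cases i <;> simp only [cellMap, id, Fin.reduceFinMk, Fin.zero_eta, Fin.mk_one] <;> linarith
  | succ m ih =>
    have hr : (0 : ℝ) < r⁻¹ := by norm_num [r]
    rw [graphEnergy_succ] at h
    replace h := nonpos_of_mul_nonpos_right h hr
    have h' : ∀ k, graphEnergy m (ψ ∘ F k) (ψ ∘ F k) ≤ 0 := fun k =>
      (Finset.single_le_sum (f := fun k => graphEnergy m (ψ ∘ F k) (ψ ∘ F k))
        (fun k _ => graphEnergy_self_nonneg m _) (Finset.mem_univ k)).trans h
    have hq : ∀ k j, ψ (F k (q j)) = ψ (F k (q 0)) := fun k j => by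
      have := ih (h' k) (List.replicate m j) j (by simp)
      rwa [cellMap_replicate_q] at this
    cases w with
    | nil => simp at hw
    | cons k w =>
      have h1 := ih (h' k) w i (by simpa using hw)
      simp only [Function.comp] at h1
      rw [cellMap, Function.comp, h1, F_q_comm, hq, F_q]

theorem graphEnergy_truncation_le (m : ℕ) (g : Plane → ℝ) (ε : ℝ) :
    graphEnergy m (fun x => max (g x - ε) 0) (fun x => max (g x - ε) 0) ≤
      graphEnergy m g (fun x => max (g x - ε) 0) := by
  have key : ∀ a b : ℝ, (max (a - ε) 0 - max (b - ε) 0) * (max (a - ε) 0 - max (b - ε) 0) ≤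
      (a - b) * (max (a - ε) 0 - max (b - ε) 0) := fun a b => by
    rcases max_cases (a - ε) 0 with ⟨h1, h2⟩ | ⟨h1, h2⟩ <;>
      rcases max_cases (b - ε) 0 with ⟨h3, h4⟩ | ⟨h3, h4⟩ <;> rw [h1, h3] <;> nlinarith
  refine mul_le_mul_of_nonneg_left (Finset.sum_le_sum fun w _ => ?_)
    (pow_nonneg (by norm_num [r]) _)
  exact add_le_add (add_le_add (key _ _) (key _ _)) (key _ _)

/-- If `g` vanishes at the corners of the gasket and solves the discrete equation away from the
corner cells of every level, then `g ≤ 0`: for large `m` the truncation `(g - ε)⁺` vanishes on the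
corner cells, so that testing with it gives it zero energy. -/
theorem nonpos_of_graphEnergy_eq_zero {g : Plane → ℝ} (hc : ContinuousOn g SG)
    (hq : ∀ j, g (q j) = 0)
    (h : ∀ (m : ℕ) (ψ : Plane → ℝ), (∀ j l, ψ (cellMap (List.replicate m j) (q l)) = 0) →
      graphEnergy m g ψ = 0) {x : Plane} (hx : x ∈ vertices) : g x ≤ 0 := by
  refine le_of_forall_pos_le_add fun ε hε => ?_
  have hev : ∀ᶠ m in atTop, ∀ j l, g (cellMap (List.replicate m j) (q l)) < ε := by
    refine eventually_all.2 fun j => eventually_all.2 fun l => ?_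
    have ht := tendsto_cellMap_replicate (x := q l) (hc (q j) (q_mem_SG j))
      fun m => cellMap_mem_SG _ (q_mem_SG l)
    rw [hq] at ht
    exact ht.eventually (gt_mem_nhds hε)
  obtain ⟨n, hn⟩ := vertex_level hx
  obtain ⟨m, hm, hmn⟩ := (hev.and (eventually_ge_atTop n)).exists
  obtain ⟨w, i, hw, rfl⟩ := hn m hmn
  have h0 : ∀ j l, max (g (cellMap (List.replicate m j) (q l)) - ε) 0 = 0 := fun j l =>
    max_eq_right (by linarith [hm j l])
  have hE := (graphEnergy_truncation_le m g ε).trans_eq (h m _ h0)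
  have h1 := eq_of_graphEnergy_self_nonpos hE w i hw
  simp only [hq, zero_sub, max_eq_right (neg_nonpos.2 hε.le), max_eq_right_iff] at h1
  linarith

/-- A continuous function that solves the discrete equation away from the corner cells of every
level is harmonic: the corners are removable, since `u` minus the harmonic function with the same
corner values vanishes by the maximum principle. -/
theorem vertexHarmonic_of_graphEnergy_eq_zero {u : Plane → ℝ} (hc : ContinuousOn u SG)
    (h : ∀ (m : ℕ) (ψ : Plane → ℝ), (∀ j l, ψ (cellMap (List.replicate m j) (q l)) = 0) →
      graphEnergy m u ψ = 0) : VertexHarmonic u := by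
  obtain ⟨v, hvc, hv, hq⟩ := exists_vertexHarmonic fun j => u (q j)
  have hv0 : ∀ (m : ℕ) (ψ : Plane → ℝ), (∀ j l, ψ (cellMap (List.replicate m j) (q l)) = 0) →
      graphEnergy m v ψ = 0 := fun m ψ hψ => by
    have h0 : ∀ j, ψ (q j) = 0 := fun j => by simpa only [cellMap_replicate_q] using hψ j j
    rw [hv.graphEnergy_eq]
    simp [energy₀, h0]
  have e : ∀ x ∈ vertices, u x = v x := fun x hx => by
    have h1 := nonpos_of_graphEnergy_eq_zero (hc.sub hvc) (fun j => by simp [hq])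
      (fun m ψ hψ => by
        refine (graphEnergy_sub_left m u v ψ).trans ?_
        rw [h m ψ hψ, hv0 m ψ hψ, sub_zero]) hx
    have h2 := nonpos_of_graphEnergy_eq_zero (hvc.sub hc) (fun j => by simp [hq])
      (fun m ψ hψ => by
        refine (graphEnergy_sub_left m v u ψ).trans ?_
        rw [h m ψ hψ, hv0 m ψ hψ, sub_zero]) hx
    simp only [Pi.sub_apply] at h1 h2
    linarith
  refine vertexHarmonic_of_eq_harmTree (b := fun l => v (q l)) fun w i => ?_
  rw [e _ ⟨w, i, rfl⟩, hv.eq_harmTree]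

/-- The normal difference at a corner is an eigenvector, with eigenvalue `3/5`, of the restriction
to the corner cell. -/
theorem VertexHarmonic.normal_difference {u : Plane → ℝ} (hu : VertexHarmonic u) (i : Fin 3)
    (m : ℕ) : 2 * u (q i) - u ((F i)^[m] (q (i + 1))) - u ((F i)^[m] (q (i - 1))) =
      r ^ m * (2 * u (q i) - u (q (i + 1)) - u (q (i - 1))) := by
  induction m generalizing u with
  | zero => simp
  | succ m ih =>
    have h1 := ih (hu.comp_F i)
    have e : ∀ j, u (F i (q j)) = harmStep i (fun l => u (q l)) j := fun j => hu [] i j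
    simp only [Function.iterate_succ_apply', Function.comp, e] at h1 ⊢
    rw [show harmStep i (fun l => u (q l)) i = u (q i) by simp [harmStep]] at h1
    rw [h1, pow_succ, mul_assoc]
    congr 1
    have e₀ : (0 : Fin 3) - 1 = 2 := rfl
    have e₁ : (1 : Fin 3) - 1 = 0 := rfl
    have e₂ : (2 : Fin 3) - 1 = 1 := rfl
    fin_cases i <;>
      simp only [Fin.reduceFinMk, Fin.zero_eta, Fin.mk_one, e₀, e₁, e₂, Fin.reduceAdd, harmStep, r,
        Fin.reduceEq, if_false] <;>
      ring

theorem hasNormalDeriv_of_vertexHarmonic {u : Plane → ℝ} {w : List (Fin 3)}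
    (hu : VertexHarmonic (u ∘ cellMap w)) (i : Fin 3) :
    HasNormalDeriv u w i ((r⁻¹) ^ w.length *
      (2 * u (cellMap w (q i)) - u (cellMap w (q (i + 1))) - u (cellMap w (q (i - 1))))) := by
  unfold HasNormalDeriv
  refine tendsto_const_nhds.congr fun m => ?_
  have h := hu.normal_difference i m
  simp only [Function.comp] at h
  rw [h, ← mul_assoc ((r⁻¹) ^ m), ← mul_pow, inv_mul_cancel₀ (by norm_num [r]), one_pow, one_mul]

/-! ### The cells of the half domain -/

/-- The point `F_0ᵏ q_1`, the common vertex of the cells `F_0ᵏ⁻¹ F_1 SG` and `F_0ᵏ F_1 SG`. -/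
def chainPoint (k : ℕ) : Plane := cellMap (List.replicate k 0) (q 1)

/-- The point `p_k` of the cut. -/
def cutPoint (k : ℕ) : Plane := cellMap (pWord k) (q 2)

theorem cellMap_pWord (k : ℕ) (x : Plane) :
    cellMap (pWord k) x = cellMap (List.replicate k 0) (F 1 x) := cellMap_append _ _ _

theorem length_pWord (k : ℕ) : (pWord k).length = k + 1 := by simp [pWord]

theorem cellMap_pWord_q_one (k : ℕ) : cellMap (pWord k) (q 1) = chainPoint k := by
  rw [cellMap_pWord, F_q, chainPoint]

theorem cellMap_pWord_q_zero (k : ℕ) : cellMap (pWord k) (q 0) = chainPoint (k + 1) := by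
  rw [cellMap_pWord, F_q_comm, chainPoint, List.replicate_succ', cellMap_append]
  rfl

theorem bary_cellMap_replicate_zero (k : ℕ) (j : Fin 3) (x : Plane) :
    bary j (cellMap (List.replicate k 0) x) =
      (1 / 2) ^ k * bary j x + if j = 0 then 1 - (1 / 2) ^ k else 0 := by
  induction k with
  | zero => simp [cellMap]
  | succ k ih =>
    rw [List.replicate_succ, cellMap, Function.comp, bary_F, ih]
    split_ifs <;> ring

theorem bary_chainPoint (k : ℕ) (j : Fin 3) :
    bary j (chainPoint k) = ![1 - (1 / 2) ^ k, (1 / 2) ^ k, 0] j := by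
  rw [chainPoint, bary_cellMap_replicate_zero, bary_q]
  fin_cases j <;> simp

theorem cutPoint_mem_SG (k : ℕ) : cutPoint k ∈ SG := cellMap_mem_SG _ (q_mem_SG 2)

theorem mem_halfDomain_iff {x : Plane} :
    x ∈ halfDomain ↔ x ∈ SG ∧ bary 2 x < bary 1 x ∧ x ≠ q 1 := by
  have h := bary_two_sub_bary_one x
  refine and_congr_right fun _ => and_congr_left fun _ => ?_
  constructor <;> intro h1 <;> linarith

theorem mem_cutSet_iff {x : Plane} : x ∈ cutSet ↔ x ∈ SG ∧ bary 2 x = bary 1 x := by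
  have h := bary_two_sub_bary_one x
  refine and_congr_right fun _ => ?_
  constructor <;> intro h1 <;> linarith

theorem mem_halfDomain_union_halfBoundary_iff {x : Plane} :
    x ∈ halfDomain ∪ halfBoundary ↔ x ∈ SG ∧ bary 2 x ≤ bary 1 x := by
  simp only [halfBoundary, mem_union, mem_singleton_iff, mem_halfDomain_iff, mem_cutSet_iff]
  constructor
  · rintro (⟨h1, h2, -⟩ | rfl | ⟨h1, h2⟩)
    · exact ⟨h1, h2.le⟩
    · exact ⟨q_mem_SG 1, by simp [bary_q]⟩
    · exact ⟨h1, h2.le⟩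
  · rintro ⟨h1, h2⟩
    by_cases hq : x = q 1
    · exact Or.inr (Or.inl hq)
    · rcases h2.lt_or_eq with h | h
      · exact Or.inl ⟨h1, h, hq⟩
      · exact Or.inr (Or.inr ⟨h1, h⟩)

theorem bary_two_cellMap_pWord (k : ℕ) (x : Plane) :
    bary 2 (cellMap (pWord k) x) = (1 / 2) ^ k * (bary 2 x / 2) := by
  rw [cellMap_pWord, bary_cellMap_replicate_zero, bary_F]; simp

theorem bary_one_cellMap_pWord (k : ℕ) (x : Plane) :
    bary 1 (cellMap (pWord k) x) = (1 / 2) ^ k * ((bary 1 x + 1) / 2) := by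
  rw [cellMap_pWord, bary_cellMap_replicate_zero, bary_F]; simp

theorem cellMap_pWord_mem_union (k : ℕ) {x : Plane} (hx : x ∈ SG) :
    cellMap (pWord k) x ∈ halfDomain ∪ halfBoundary := by
  rw [mem_halfDomain_union_halfBoundary_iff, bary_two_cellMap_pWord, bary_one_cellMap_pWord]
  refine ⟨cellMap_mem_SG _ hx, mul_le_mul_of_nonneg_left ?_ (by positivity)⟩
  linarith [bary_le_one hx 2, bary_nonneg hx 1]

theorem cellMap_pWord_mem_halfDomain (k : ℕ) {x : Plane} (hx : x ∈ SG) (h1 : x ≠ q 1)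
    (h2 : x ≠ q 2) : cellMap (pWord k) x ∈ halfDomain := by
  rw [mem_halfDomain_iff, bary_two_cellMap_pWord, bary_one_cellMap_pWord]
  refine ⟨cellMap_mem_SG _ hx, mul_lt_mul_of_pos_left ?_ (by positivity),
    fun h => h1 (eq_replicate_of_cellMap_eq_q hx h).2⟩
  have h3 : bary 2 x < 1 := (bary_le_one hx 2).lt_of_ne fun h => h2 (eq_q_of_bary_eq_one hx h)
  linarith [bary_nonneg hx 1]

theorem cutPoint_mem_cutSet (k : ℕ) : cutPoint k ∈ cutSet := by
  rw [mem_cutSet_iff, cutPoint, bary_two_cellMap_pWord, bary_one_cellMap_pWord, bary_q, bary_q]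
  exact ⟨cutPoint_mem_SG k, by simp⟩

theorem q_zero_mem_cutSet : q 0 ∈ cutSet := by
  rw [mem_cutSet_iff, bary_q, bary_q]
  exact ⟨q_mem_SG 0, by simp⟩

/-- The cut consists of the points `p_k` and their limit `q 0`. -/
theorem eq_cutPoint_or_eq_q_zero {x : Plane} (hx : x ∈ cutSet) :
    (∃ k, x = cutPoint k) ∨ x = q 0 := by
  rw [mem_cutSet_iff] at hx
  obtain ⟨hx, hb⟩ := hx
  by_contra! hne
  -- one step of the descent: the symmetric part of `SG` is `p_0` and the image of itself by `F 0`
  have step : ∀ y ∈ SG, bary 2 y = bary 1 y → y = cutPoint 0 ∨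
      ∃ z ∈ SG, bary 2 z = bary 1 z ∧ F 0 z = y := by
    intro y hy hyb
    rw [SG_eq_iUnion] at hy
    obtain ⟨i, z, hz, rfl⟩ := mem_iUnion.1 hy
    have h1 := bary_le_one hz 1
    have h2 := bary_le_one hz 2
    have h3 := bary_nonneg hz 1
    have h4 := bary_nonneg hz 2
    rw [bary_F, bary_F] at hyb
    fin_cases i
    · simp only [Fin.zero_eta, Fin.reduceEq, if_false] at hyb
      exact Or.inr ⟨z, hz, by linarith, rfl⟩
    · simp only [Fin.mk_one, Fin.reduceEq, if_false, if_true] at hyb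
      rw [eq_q_of_bary_eq_one hz (i := 2) (by linarith)]
      exact Or.inl rfl
    · simp only [Fin.reduceFinMk, Fin.reduceEq, if_false, if_true] at hyb
      rw [eq_q_of_bary_eq_one hz (i := 1) (by linarith)]
      exact Or.inl (F_q_comm 2 1)
  have hall : ∀ n, ∃ z ∈ SG, bary 2 z = bary 1 z ∧ cellMap (List.replicate n 0) z = x := by
    intro n
    induction n with
    | zero => exact ⟨x, hx, hb, rfl⟩
    | succ n ih =>
      obtain ⟨z, hz, hzb, rfl⟩ := ih
      rcases step z hz hzb with rfl | ⟨y, hy, hyb, rfl⟩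
      · exact absurd (cellMap_pWord n (q 2)).symm (hne.1 n)
      · exact ⟨y, hy, hyb, by rw [List.replicate_succ', cellMap_append]; rfl⟩
  refine hne.2 (eq_q_of_bary_eq_one hx (le_antisymm (bary_le_one hx 0) ?_))
  have ht : Tendsto (fun n : ℕ => 1 - (1 / 2 : ℝ) ^ n) atTop (𝓝 1) := by
    simpa using (tendsto_pow_atTop_nhds_zero_of_lt_one (r := (1 / 2 : ℝ)) (by norm_num)
      (by norm_num)).const_sub 1
  refine le_of_tendsto' ht fun n => ?_
  obtain ⟨z, hz, -, rfl⟩ := hall n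
  rw [bary_cellMap_replicate_zero, if_pos rfl]
  have := mul_nonneg (pow_nonneg (by norm_num : (0 : ℝ) ≤ 1 / 2) n) (bary_nonneg hz 0)
  linarith

theorem tendsto_chainPoint {u : Plane → ℝ} (hc : ContinuousOn u (halfDomain ∪ halfBoundary)) :
    Tendsto (fun k => u (chainPoint k)) atTop (𝓝 (u (q 0))) :=
  tendsto_cellMap_replicate (hc _ (Or.inr (Or.inr q_zero_mem_cutSet))) fun k => by
    change chainPoint k ∈ _
    rw [← cellMap_pWord_q_one]
    exact cellMap_pWord_mem_union k (q_mem_SG 1)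

theorem tendsto_cutPoint {u : Plane → ℝ} (hc : ContinuousOn u (halfDomain ∪ halfBoundary)) :
    Tendsto (fun k => u (cutPoint k)) atTop (𝓝 (u (q 0))) := by
  have h := tendsto_cellMap_replicate (x := F 1 (q 2)) (hc _ (Or.inr (Or.inr q_zero_mem_cutSet)))
    fun k => by
      rw [← cellMap_pWord]
      exact cellMap_pWord_mem_union k (q_mem_SG 2)
  simpa only [← cellMap_pWord, cutPoint] using h

/-! ### Harmonicity on the cells and matching conditions -/

theorem graphEnergy_eq_of_supported {w : List (Fin 3)} {v : Plane → ℝ}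
    (hv : ∀ w' : List (Fin 3), w'.length = w.length → w' ≠ w → ∀ y ∈ SG, v (cellMap w' y) = 0)
    (m : ℕ) (u : Plane → ℝ) : graphEnergy (w.length + m) u v =
      (r⁻¹) ^ w.length * graphEnergy m (u ∘ cellMap w) (v ∘ cellMap w) := by
  induction w generalizing u v with
  | nil => simp [cellMap]
  | cons i w ih =>
    rw [List.length_cons, Nat.succ_add, Nat.succ_eq_add_one, graphEnergy_succ,
      Finset.sum_eq_single i, ih (fun w' hw' hne y hy => hv (i :: w') (by simp [hw'])
        (by simpa using hne) y hy), pow_succ']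
    · rw [mul_assoc]
      rfl
    · intro j _ hj
      refine graphEnergy_eq_zero fun w' l _ => ?_
      obtain ⟨w₁, hw₁, y, hy, e⟩ := exists_cell w.length (cellMap_mem_SG w' (q_mem_SG l))
      rw [← e]
      exact hv (j :: w₁) (by simp [hw₁]) (by simp [hj]) y hy
    · simp

/-- On each cell `F_0ᵏ F_1 SG` a solution solves the discrete equation away from the corner cells:
a test function on the cell that vanishes there extends by zero. -/
theorem graphEnergy_comp_pWord_eq_zero {u : Plane → ℝ} (hu : IsHarmonicIn halfDomain u)
    (k m : ℕ) (ψ : Plane → ℝ) (hψ : ∀ j l, ψ (cellMap (List.replicate m j) (q l)) = 0) :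
    graphEnergy m (u ∘ cellMap (pWord k)) ψ = 0 := by
  have hψq : ∀ j, ψ (q j) = 0 := fun j => by simpa only [cellMap_replicate_q] using hψ j j
  have hinj : Function.Injective fun y : SG => cellMap (pWord k) y := fun x y hxy => by
    have := dist_cellMap (pWord k) x y
    simp only at hxy
    rw [hxy, dist_self, eq_comm, mul_eq_zero] at this
    exact Subtype.ext (dist_eq_zero.1 (this.resolve_left (by positivity)))
  set φ : Plane → ℝ := Function.extend (fun y : SG => cellMap (pWord k) y) (fun y => ψ y) 0
  have h1 : ∀ y ∈ SG, φ (cellMap (pWord k) y) = ψ y := fun y hy =>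
    hinj.extend_apply (fun y : SG => ψ y) 0 ⟨y, hy⟩
  have h2 : ∀ w' : List (Fin 3), w'.length = (pWord k).length → w' ≠ pWord k → ∀ y ∈ SG,
      φ (cellMap w' y) = 0 := by
    intro w' hl hne y hy
    by_cases hex : ∃ z : SG, cellMap (pWord k) z = cellMap w' y
    · obtain ⟨⟨z, hz⟩, hzy⟩ := hex
      rcases eq_or_vertices_of_cellMap_eq hl hy hz hzy.symm with h | ⟨i, j, -, rfl⟩
      · exact absurd h hne
      · rw [← hzy, h1 _ hz, hψq]
    · exact Function.extend_apply' _ _ _ hex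
  have h3 := hu.graphEnergy_eq_zero ((pWord k).length + m) φ fun w' i hw' hne => by
    have hsplit : w' = w'.take (pWord k).length ++ w'.drop (pWord k).length :=
      (List.take_append_drop _ _).symm
    have hlt : (w'.take (pWord k).length).length = (pWord k).length := by
      rw [List.length_take]; omega
    have hld : (w'.drop (pWord k).length).length = m := by rw [List.length_drop]; omega
    generalize w'.take (pWord k).length = a at hsplit hlt
    generalize w'.drop (pWord k).length = b at hsplit hld
    subst hsplit
    rw [cellMap_append] at hne
    have hm := cellMap_mem_SG b (q_mem_SG i)
    have ha : a = pWord k := by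
      by_contra hak
      exact hne (h2 a hlt hak _ hm)
    subst ha
    rw [h1 _ hm] at hne
    have hcorner : ∀ j, ∀ x ∈ SG, cellMap b x ≠ q j := fun j x hx hxj => by
      have hb := (eq_replicate_of_cellMap_eq_q hx hxj).1
      rw [hld] at hb
      exact hne (by rw [hb, hψ])
    rintro _ ⟨x, hx, rfl⟩
    rw [cellMap_append]
    exact cellMap_pWord_mem_halfDomain k (cellMap_mem_SG b hx) (hcorner 1 x hx) (hcorner 2 x hx)
  rw [graphEnergy_eq_of_supported h2] at h3
  have h4 := (mul_eq_zero.1 h3).resolve_left (pow_ne_zero _ (by norm_num [r]))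
  rw [← h4]
  exact graphEnergy_congr (fun _ _ _ => rfl) fun w i _ =>
    (h1 _ (cellMap_mem_SG w (q_mem_SG i))).symm

/-- A solution is harmonic on each cell `F_0ᵏ F_1 SG`, although this cell touches the boundary. -/
theorem vertexHarmonic_comp_pWord {u : Plane → ℝ}
    (hc : ContinuousOn u (halfDomain ∪ halfBoundary)) (hu : IsHarmonicIn halfDomain u) (k : ℕ) :
    VertexHarmonic (u ∘ cellMap (pWord k)) :=
  vertexHarmonic_of_graphEnergy_eq_zero
    (hc.comp (continuous_cellMap _).continuousOn fun _ hx => cellMap_pWord_mem_union k hx)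
    (graphEnergy_comp_pWord_eq_zero hu k)

/-- For `u` harmonic on all cells `F_0ᵏ F_1 SG`, the energy pairing with a function supported on
the first `n` of them is the sum of the pairings on these cells, at every level from `n` on. -/
theorem graphEnergy_eq_sum {u v : Plane → ℝ}
    (hu : ∀ k, VertexHarmonic (u ∘ cellMap (pWord k))) {n : ℕ}
    (hv : ∀ k < n, ∀ y ∈ SG, v (cellMap (List.replicate k 0) (F 2 y)) = 0)
    (hv' : ∀ y ∈ SG, v (cellMap (List.replicate n 0) y) = 0) {m : ℕ} (hm : n ≤ m) :
    graphEnergy m u v = ∑ k ∈ Finset.range n,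
      (r⁻¹) ^ (k + 1) * energy₀ (u ∘ cellMap (pWord k)) (v ∘ cellMap (pWord k)) := by
  induction n generalizing u v m with
  | zero => simpa using graphEnergy_eq_zero fun w i _ => hv' _ (cellMap_mem_SG w (q_mem_SG i))
  | succ n ih =>
    obtain ⟨m, rfl⟩ : ∃ l, m = l + 1 := ⟨m - 1, by omega⟩
    have h0 := ih (u := u ∘ F 0) (v := v ∘ F 0) (fun k => hu (k + 1))
      (fun k hk y hy => hv (k + 1) (by omega) y hy) hv' (m := m) (by omega)
    have h1 : VertexHarmonic (u ∘ F 1) := hu 0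
    have h2 : graphEnergy m (u ∘ F 2) (v ∘ F 2) = 0 :=
      graphEnergy_eq_zero fun w i _ => hv 0 (by omega) _ (cellMap_mem_SG w (q_mem_SG i))
    rw [graphEnergy_succ, Fin.sum_univ_three, h0, h1.graphEnergy_eq, h2, Finset.sum_range_succ',
      add_zero, mul_add, Finset.mul_sum]
    congr 1
    · refine Finset.sum_congr rfl fun k _ => ?_
      rw [pow_succ' _ (k + 1), mul_assoc]
      rfl
    · rw [zero_add, pow_one]
      rfl

/-- The pairing on the cell `F_0ᵏ F_1 SG` with a function that vanishes at `p_k`, in terms of the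
normal differences of `u` at the two other corners. -/
theorem energy₀_comp_pWord (u v : Plane → ℝ) (k : ℕ) (h : v (cutPoint k) = 0) :
    energy₀ (u ∘ cellMap (pWord k)) (v ∘ cellMap (pWord k)) =
      v (chainPoint (k + 1)) * (2 * u (chainPoint (k + 1)) - u (chainPoint k) - u (cutPoint k)) +
        v (chainPoint k) * (2 * u (chainPoint k) - u (chainPoint (k + 1)) - u (cutPoint k)) := by
  simp only [energy₀, Function.comp, cellMap_pWord_q_one, cellMap_pWord_q_zero]
  rw [show cellMap (pWord k) (q 2) = cutPoint k from rfl, h]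
  ring

theorem abs_bary_cellMap_sub_le (w : List (Fin 3)) {x y : Plane} (hx : x ∈ SG) (hy : y ∈ SG)
    (j : Fin 3) : |bary j (cellMap w x) - bary j (cellMap w y)| ≤ (1 / 2) ^ w.length := by
  induction w with
  | nil =>
    have := bary_le_one hx j
    have := bary_le_one hy j
    have := bary_nonneg hx j
    have := bary_nonneg hy j
    simp only [cellMap, id, List.length_nil, pow_zero]
    exact abs_le.2 ⟨by linarith, by linarith⟩
  | cons i w ih =>
    simp only [cellMap, Function.comp, bary_F, List.length_cons, pow_succ]
    rw [abs_le] at ih ⊢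
    constructor <;> linarith [ih.1, ih.2]

/-- At the common vertex of two consecutive cells `F_0ᵏ F_1 SG` the normal derivatives of a
solution add up to zero: test with the spline through the indicator function of this vertex. -/
theorem matching {u : Plane → ℝ} (hc : ContinuousOn u (halfDomain ∪ halfBoundary))
    (hu : IsHarmonicIn halfDomain u) (k : ℕ) :
    3 / 5 * (2 * u (chainPoint (k + 1)) - u (chainPoint k) - u (cutPoint k)) +
      (2 * u (chainPoint (k + 1)) - u (chainPoint (k + 2)) - u (cutPoint (k + 1))) = 0 := by
  classical
  set φ : Plane → ℝ := fun x => if x = chainPoint (k + 1) then 1 else 0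
  have hp : (0 : ℝ) < (1 / 2) ^ (k + 1) := by positivity
  have hne : ∀ {x : Plane} (j : Fin 3), bary j x ≠ ![1 - (1 / 2) ^ (k + 1), (1 / 2) ^ (k + 1), 0] j →
      φ x = 0 := fun {x} j h => if_neg fun e => h (by rw [e, bary_chainPoint])
  -- The barycentric coordinates of the vertex are `1 - 2⁻ᵏ⁻¹`, `2⁻ᵏ⁻¹` and `0`; on a cell of level
  -- `k + 3` that contains it they vary by at most `2⁻ᵏ⁻³`, so that the cell lies in `Ω`.
  have h1 : graphEnergy (k + 3) u φ = 0 := by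
    refine hu.graphEnergy_eq_zero _ _ fun w i hw hi => ?_
    have hi : cellMap w (q i) = chainPoint (k + 1) := by
      by_contra h
      exact hi (if_neg h)
    rintro _ ⟨x, hx, rfl⟩
    have h1 := abs_le.1 (abs_bary_cellMap_sub_le w hx (q_mem_SG i) 1)
    have h2 := abs_le.1 (abs_bary_cellMap_sub_le w hx (q_mem_SG i) 2)
    rw [hi, hw, bary_chainPoint, show k + 3 = k + 1 + 2 from rfl, pow_add] at h1 h2
    simp only [Matrix.cons_val] at h1 h2
    have hle : (1 / 2 : ℝ) ^ (k + 1) ≤ 1 / 2 := by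
      rw [pow_succ]
      have := pow_le_one₀ (n := k) (by norm_num : (0 : ℝ) ≤ 1 / 2) (by norm_num)
      linarith
    refine mem_halfDomain_iff.2 ⟨cellMap_mem_SG w hx, by linarith, fun hq => ?_⟩
    rw [hq, bary_q, if_pos rfl] at h1
    linarith
  rw [graphEnergy_eq_sum (n := k + 2) (vertexHarmonic_comp_pWord hc hu) ?_ ?_ (by omega)] at h1
  · have hcut : ∀ j, φ (cutPoint j) = 0 := fun j => hne 2 (by
      rw [cutPoint, bary_two_cellMap_pWord, bary_q]
      simp)
    have hchain : ∀ j, φ (chainPoint j) = if j = k + 1 then 1 else 0 := fun j => by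
      split_ifs with hj
      · rw [hj]; exact if_pos rfl
      · refine hne 1 ?_
        rw [bary_chainPoint]
        simpa using hj
    rw [Finset.sum_range_succ, Finset.sum_range_succ, Finset.sum_eq_zero fun j hj => ?_] at h1
    · rw [energy₀_comp_pWord _ _ _ (hcut _), energy₀_comp_pWord _ _ _ (hcut _)] at h1
      simp only [hchain, if_true, if_neg (show k ≠ k + 1 by omega),
        if_neg (show k + 1 + 1 ≠ k + 1 by omega)] at h1
      rw [pow_succ _ (k + 1)] at h1
      have hr : (r⁻¹) ^ (k + 1) ≠ 0 := pow_ne_zero _ (by norm_num [r])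
      have h2 := (mul_eq_zero.1 (show (r⁻¹) ^ (k + 1) * _ = 0 from by
        rw [← h1, mul_assoc, zero_add, ← mul_add])).resolve_left hr
      norm_num [r] at h2
      linarith
    · rw [energy₀_comp_pWord _ _ _ (hcut _), hchain, hchain, if_neg, if_neg]
      · ring
      · have := Finset.mem_range.1 hj; omega
      · have := Finset.mem_range.1 hj; omega
  · intro j _ y hy
    refine hne 2 ?_
    rw [bary_cellMap_replicate_zero, bary_F]
    have := bary_nonneg hy 2
    simp only [Matrix.cons_val, Fin.reduceEq, if_true, if_false, add_zero]
    positivity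
  · intro y hy
    refine hne 0 (ne_of_gt ?_)
    rw [bary_cellMap_replicate_zero, show (1 / 2 : ℝ) ^ (k + 2) = (1 / 2) ^ (k + 1) * (1 / 2) from
      pow_succ _ _]
    have := mul_nonneg hp.le (bary_nonneg hy 0)
    simp only [Matrix.cons_val, if_true]
    linarith

/-! ### The normal derivatives of a solution -/

theorem hasNormalDeriv_cutPoint {u : Plane → ℝ} {k : ℕ}
    (hu : VertexHarmonic (u ∘ cellMap (pWord k))) :
    HasNormalDeriv u (pWord k) 2 ((5 / 3) ^ (k + 1) *
      (2 * u (cutPoint k) - u (chainPoint k) - u (chainPoint (k + 1)))) := by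
  have h := hasNormalDeriv_of_vertexHarmonic hu 2
  rw [length_pWord, show (2 : Fin 3) + 1 = 0 from rfl, show (2 : Fin 3) - 1 = 1 from rfl,
    cellMap_pWord_q_one, cellMap_pWord_q_zero] at h
  convert h using 1
  rw [show cellMap (pWord k) (q 2) = cutPoint k from rfl, show (r⁻¹ : ℝ) = 5 / 3 by norm_num [r]]
  ring

/-- The normal derivative at `q_1` is defined through the whole gasket, but the difference quotient
of level `m + 1` only sees the cell `F_1 SG`. -/
theorem hasNormalDeriv_leftVertex {u : Plane → ℝ} (hu : VertexHarmonic (u ∘ cellMap (pWord 0))) :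
    HasNormalDeriv u [] 1
      (5 / 3 * (2 * u (chainPoint 0) - u (chainPoint 1) - u (cutPoint 0))) := by
  have h : Tendsto _ _ _ := hasNormalDeriv_of_vertexHarmonic hu 1
  have e : (r⁻¹ : ℝ) = 5 / 3 := by norm_num [r]
  refine (tendsto_add_atTop_iff_nat 1).1 ?_
  convert h using 2 with m
  · have hF : ∀ x, cellMap (pWord 0) x = F 1 x := fun x => rfl
    simp only [length_pWord, Function.iterate_succ_apply', hF, cellMap, id, F_q, List.length_nil]
    ring
  · rw [length_pWord, show (1 : Fin 3) + 1 = 2 from rfl, show (1 : Fin 3) - 1 = 0 from rfl,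
      cellMap_pWord_q_one, cellMap_pWord_q_zero, e]
    rw [show cellMap (pWord 0) (q 2) = cutPoint 0 from rfl]
    ring

/-- The series `∑ (2 f_k - u_k - u_{k+1})` converges if `u` and `f` have the same limit and the
matching conditions hold. With `b_k = 2 u_{k+1} - u_k - f_k` its terms are
`(3/4) (b_{k-1} - b_k) - (3/4) (u_{k+1} - u_k)` for `k ≥ 1`, so that it telescopes. -/
theorem seriesConverges_of_matching {u f : ℕ → ℝ} {L : ℝ} (hu : Tendsto u atTop (𝓝 L))
    (hf : Tendsto f atTop (𝓝 L))
    (hm : ∀ k, 3 / 5 * (2 * u (k + 1) - u k - f k) + (2 * u (k + 1) - u (k + 2) - f (k + 1)) = 0) :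
    SeriesConverges fun k => 2 * f k - u k - u (k + 1) := by
  have hsum : ∀ n, ∑ k ∈ Finset.range (n + 1), (2 * f k - u k - u (k + 1)) =
      2 * f 0 - u 0 - u 1 + 3 / 4 * ((2 * u 1 - u 0 - f 0) - (2 * u (n + 1) - u n - f n)) -
        3 / 4 * (u (n + 1) - u 1) := fun n => by
    induction n with
    | zero => simp
    | succ n ih =>
      rw [Finset.sum_range_succ, ih]
      linarith [hm n]
  have hu1 : Tendsto (fun n => u (n + 1)) atTop (𝓝 L) := (tendsto_add_atTop_iff_nat 1).2 hu
  have ht := ((((hu1.const_mul 2).sub hu).sub hf).const_sub (2 * u 1 - u 0 - f 0)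
    |>.const_mul (3 / 4) |>.const_add (2 * f 0 - u 0 - u 1)).sub
    ((hu1.sub_const (u 1)).const_mul (3 / 4))
  exact ⟨_, (tendsto_add_atTop_iff_nat 1).1 (ht.congr fun n => (hsum n).symm)⟩

/-! ### Boundary values from normal derivatives -/

/-- A recursion `e (n + 1) = (3/5) e n + δ n` with `δ n → 0` drives `e` to zero. -/
theorem tendsto_zero_of_recursion {e δ : ℕ → ℝ} (hδ : Tendsto δ atTop (𝓝 0))
    (he : ∀ n, e (n + 1) = 3 / 5 * e n + δ n) : Tendsto e atTop (𝓝 0) := by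
  rw [Metric.tendsto_atTop] at hδ ⊢
  intro ε hε
  obtain ⟨N, hN⟩ := hδ (ε / 5) (by positivity)
  have hb : ∀ k, |e (N + k)| ≤ (3 / 5) ^ k * |e N| + ε / 2 := by
    intro k
    induction k with
    | zero => simp; linarith
    | succ k ih =>
      have h1 := hN (N + k) (by omega)
      rw [Real.dist_eq, sub_zero] at h1
      rw [← add_assoc, he, pow_succ]
      have h2 := abs_add_le (3 / 5 * e (N + k)) (δ (N + k))
      rw [abs_mul, abs_of_pos (by norm_num : (0 : ℝ) < 3 / 5)] at h2
      linarith
  have ht : Tendsto (fun k : ℕ => (3 / 5 : ℝ) ^ k * |e N|) atTop (𝓝 0) := by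
    simpa using (tendsto_pow_atTop_nhds_zero_of_lt_one (r := (3 / 5 : ℝ)) (by norm_num)
      (by norm_num)).mul_const |e N|
  obtain ⟨K, hK⟩ := eventually_atTop.1 (ht.eventually (gt_mem_nhds (half_pos hε)))
  refine ⟨N + K, fun n hn => ?_⟩
  obtain ⟨k, rfl⟩ := Nat.exists_eq_add_of_le (show N ≤ n by omega)
  rw [Real.dist_eq, sub_zero]
  linarith [hb k, hK k (by omega)]

/-- Values `u k` at the points `F_0ᵏ q_1` and `f k` at the points `p_k` that satisfy the matching
conditions and have prescribed normal derivatives. The normal differences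
`A k = 2 u_k - u_{k+1} - f_k` satisfy `A (k + 1) = (3/5) (A k + η k)`. Together with `A` and the
partial sums of `η`, the sequences `u` and `f` converge, to the same limit. -/
theorem exists_chain_values (ηₘ₁ : ℝ) (η : ℕ → ℝ) {s : ℝ}
    (hs : Tendsto (fun n : ℕ => ηₘ₁ + ∑ k ∈ Finset.range n, η k) atTop (𝓝 s)) :
    ∃ (u f : ℕ → ℝ) (L : ℝ), Tendsto u atTop (𝓝 L) ∧ Tendsto f atTop (𝓝 L) ∧ u 0 = 0 ∧
      2 * u 0 - u 1 - f 0 = 3 / 5 * ηₘ₁ ∧ (∀ k, 2 * f k - u k - u (k + 1) = η k) ∧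
      ∀ k, 3 / 5 * (2 * u (k + 1) - u k - f k) + (2 * u (k + 1) - u (k + 2) - f (k + 1)) = 0 := by
  set A : ℕ → ℝ := fun n => Nat.rec (3 / 5 * ηₘ₁) (fun k a => 3 / 5 * (a + η k)) n
  have hA0 : A 0 = 3 / 5 * ηₘ₁ := rfl
  have hA1 : ∀ k, A (k + 1) = 3 / 5 * (A k + η k) := fun k => rfl
  have hη : Tendsto η atTop (𝓝 0) := by
    have h := ((tendsto_add_atTop_iff_nat 1).2 hs).sub hs
    rw [sub_self] at h
    refine h.congr fun n => ?_
    rw [Finset.sum_range_succ]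
    ring
  have hAt : Tendsto A atTop (𝓝 0) :=
    tendsto_zero_of_recursion (δ := fun k => 3 / 5 * η k) (by simpa using hη.const_mul (3 / 5))
      fun n => by rw [hA1]; ring
  set S : ℕ → ℝ := fun n => ∑ k ∈ Finset.range n, η k
  have hS1 : ∀ n, S (n + 1) = S n + η n := fun n => Finset.sum_range_succ _ _
  have hSt : Tendsto S atTop (𝓝 (s - ηₘ₁)) :=
    (hs.sub_const ηₘ₁).congr fun n => add_sub_cancel_left _ _
  have hS0 : S 0 = 0 := rfl
  -- Closed form of the recursion `u (n + 1) = u n - (η n + 2 A n) / 3`, by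
  -- `∑_{k < n} A k = (5/2) (A 0 + (3/5) S n - A n)`.
  set u : ℕ → ℝ := fun n => -(5 * (A 0 - A n) + 4 * S n) / 3 with hu
  have hut : Tendsto u atTop (𝓝 (-(5 * (A 0 - 0) + 4 * (s - ηₘ₁)) / 3)) :=
    ((((hAt.const_sub (A 0)).const_mul 5).add (hSt.const_mul 4)).neg).div_const 3
  refine ⟨u, fun n => u n + (η n - A n) / 3, _, hut, ?_, ?_, ?_, fun k => ?_, fun k => ?_⟩
  · simpa using hut.add ((hη.sub hAt).div_const 3)
  · simp [hu, hS0]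
  · simp only [hu, hA1 0, hS1 0, hS0]
    linarith
  · simp only [hu, hA1, hS1]
    ring
  · simp only [hu, hA1, hS1]
    ring

theorem chain_values_unique {u f u' f' : ℕ → ℝ} (h₀ : u 0 = u' 0)
    (h₁ : 2 * u 0 - u 1 - f 0 = 2 * u' 0 - u' 1 - f' 0)
    (hη : ∀ k, 2 * f k - u k - u (k + 1) = 2 * f' k - u' k - u' (k + 1))
    (hm : ∀ k, 3 / 5 * (2 * u (k + 1) - u k - f k) + (2 * u (k + 1) - u (k + 2) - f (k + 1)) = 0)
    (hm' : ∀ k, 3 / 5 * (2 * u' (k + 1) - u' k - f' k) +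
      (2 * u' (k + 1) - u' (k + 2) - f' (k + 1)) = 0) (k : ℕ) : f k = f' k := by
  have key : ∀ k, u k = u' k ∧ 2 * u k - u (k + 1) - f k = 2 * u' k - u' (k + 1) - f' k := by
    intro k
    induction k with
    | zero => exact ⟨h₀, h₁⟩
    | succ k ih =>
      obtain ⟨i1, i2⟩ := ih
      constructor <;> linarith [hη k, hm k, hm' k]
  obtain ⟨i1, i2⟩ := key k
  linarith [hη k]

/-! ### Solutions with prescribed values on the chain of cells -/

/-- The vertex values of the function that is harmonic on each cell `F_0ᵏ F_1 SG`, has the values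
`u k` at `F_0ᵏ q_1`, `f k` at `p_k` and `L` at `q 0`, and is continued to the right half of the
gasket by reflection. -/
def chainTree (L : ℝ) : (ℕ → ℝ) → (ℕ → ℝ) → List (Fin 3) → Fin 3 → ℝ
  | u, _, [] => ![L, u 0, u 0]
  | u, f, i :: w =>
    ![chainTree L (fun k => u (k + 1)) (fun k => f (k + 1)) w, harmTree ![u 1, u 0, f 0] w,
      harmTree ![u 1, f 0, u 0] w] i

theorem compatible_chainTree (L : ℝ) (u f : ℕ → ℝ) : Compatible (chainTree L u f) where
  fixed w i := by
    induction w generalizing u f with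
    | nil => fin_cases i <;> rfl
    | cons j w ih =>
      fin_cases j
      · exact ih _ _
      · exact (compatible_harmTree _).fixed w i
      · exact (compatible_harmTree _).fixed w i
  shared w i j := by
    induction w generalizing u f with
    | nil => fin_cases i <;> fin_cases j <;> rfl
    | cons k w ih =>
      fin_cases k
      · exact ih _ _
      · exact (compatible_harmTree _).shared w i j
      · exact (compatible_harmTree _).shared w i j

theorem abs_chainTree_sub_le {L ε : ℝ} (hε : 0 ≤ ε) {u f : ℕ → ℝ} (hu : ∀ k, |u k - L| ≤ ε)
    (hf : ∀ k, |f k - L| ≤ ε) (w : List (Fin 3)) (i : Fin 3) : |chainTree L u f w i - L| ≤ ε := by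
  have htree : ∀ (b : Fin 3 → ℝ) (w : List (Fin 3)), (∀ i, |b i - L| ≤ ε) →
      |harmTree b w i - L| ≤ ε := fun b w hb => by
    have h1 := le_harmTree (b := b) (c := L - ε) (fun i => by linarith [(abs_le.1 (hb i)).1]) w i
    have h2 := harmTree_le (b := b) (c := L + ε) (fun i => by linarith [(abs_le.1 (hb i)).2]) w i
    exact abs_le.2 ⟨by linarith, by linarith⟩
  induction w generalizing u f with
  | nil =>
    fin_cases i
    · simpa [chainTree] using hε
    · exact hu 0
    · exact hu 0
  | cons j w ih =>
    fin_cases j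
    · exact ih (fun k => hu (k + 1)) fun k => hf (k + 1)
    · refine htree _ w fun l => ?_
      fin_cases l
      · exact hu 1
      · exact hu 0
      · exact hf 0
    · refine htree _ w fun l => ?_
      fin_cases l
      · exact hu 1
      · exact hf 0
      · exact hu 0

theorem smallOsc_chainTree {L : ℝ} {u f : ℕ → ℝ} (hu : Tendsto u atTop (𝓝 L))
    (hf : Tendsto f atTop (𝓝 L)) {ε : ℝ} (hε : 0 < ε) : SmallOsc ε (chainTree L u f) := by
  have key : ∀ (N : ℕ) (u f : ℕ → ℝ), (∀ k, N ≤ k → |u k - L| ≤ ε / 2 ∧ |f k - L| ≤ ε / 2) →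
      SmallOsc ε (chainTree L u f) := by
    intro N
    induction N with
    | zero =>
      intro u f h
      refine ⟨0, fun w _ w' i j => ?_⟩
      have hb := abs_chainTree_sub_le (half_pos hε).le (fun k => (h k (Nat.zero_le k)).1)
        fun k => (h k (Nat.zero_le k)).2
      have h1 := abs_le.1 (hb (w ++ w') j)
      have h2 := abs_le.1 (hb w i)
      exact abs_le.2 ⟨by linarith, by linarith⟩
    | succ N ih =>
      intro u f h
      refine SmallOsc.of_cons fun i => ?_
      fin_cases i
      · exact ih _ _ fun k hk => h (k + 1) (by omega)
      · exact smallOsc_harmTree _ hε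
      · exact smallOsc_harmTree _ hε
  have hev : ∀ {a : ℕ → ℝ}, Tendsto a atTop (𝓝 L) → ∀ᶠ k in atTop, |a k - L| ≤ ε / 2 :=
    fun ha => (ha.eventually (Metric.closedBall_mem_nhds L (half_pos hε))).mono
      fun k hk => by rwa [Real.dist_eq] at hk
  obtain ⟨N, hN⟩ := eventually_atTop.1 ((hev hu).and (hev hf))
  exact key N u f hN

theorem chainTree_pWord_append (L : ℝ) (u f : ℕ → ℝ) (k : ℕ) (w : List (Fin 3)) :
    chainTree L u f (pWord k ++ w) = harmTree ![u (k + 1), u k, f k] w := by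
  induction k generalizing u f with
  | zero => rfl
  | succ k ih => exact ih _ _

theorem exists_chain_function {L : ℝ} {u f : ℕ → ℝ} (hu : Tendsto u atTop (𝓝 L))
    (hf : Tendsto f atTop (𝓝 L)) :
    ∃ g : Plane → ℝ, ContinuousOn g SG ∧ (∀ k, VertexHarmonic (g ∘ cellMap (pWord k))) ∧
      (∀ k, g (chainPoint k) = u k) ∧ ∀ k, g (cutPoint k) = f k := by
  obtain ⟨g, hc, hg⟩ := exists_continuousOn_of_compatible (compatible_chainTree L u f)
    fun ε hε => smallOsc_chainTree hu hf hε
  have h : ∀ k w i, (g ∘ cellMap (pWord k)) (cellMap w (q i)) =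
      harmTree ![u (k + 1), u k, f k] w i := fun k w i => by
    rw [Function.comp, ← cellMap_append, hg, chainTree_pWord_append]
  refine ⟨g, hc, fun k => vertexHarmonic_of_eq_harmTree (h k), fun k => ?_, fun k => h k [] 2⟩
  rw [← cellMap_pWord_q_one]
  exact h k [] 1

/-- A cell strictly to the left of the symmetry line lies in one of the cells `F_0ᵏ F_1 SG`. -/
theorem exists_eq_pWord_append {w : List (Fin 3)}
    (h : ∀ x ∈ SG, bary 2 (cellMap w x) < bary 1 (cellMap w x)) : ∃ k w', w = pWord k ++ w' := by
  induction w with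
  | nil => simpa [cellMap, bary_q] using h (q 0) (q_mem_SG 0)
  | cons i w ih =>
    simp only [cellMap, Function.comp, bary_F] at h
    fin_cases i
    · simp only [Fin.zero_eta, Fin.reduceEq, if_false] at h
      obtain ⟨k, w', rfl⟩ := ih fun x hx => by linarith [h x hx]
      exact ⟨k + 1, w', rfl⟩
    · exact ⟨0, w, rfl⟩
    · simp only [Fin.reduceFinMk, Fin.reduceEq, if_false, if_true] at h
      have hm := cellMap_mem_SG w (q_mem_SG 0)
      linarith [h _ (q_mem_SG 0), bary_le_one hm 1, bary_nonneg hm 2]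

/-- A function that is harmonic on every cell `F_0ᵏ F_1 SG` and satisfies the matching conditions
is weakly harmonic in the half domain: summation by parts along the chain of cells. -/
theorem isHarmonicIn_of_matching {u : Plane → ℝ}
    (hu : ∀ k, VertexHarmonic (u ∘ cellMap (pWord k)))
    (hm : ∀ k, 3 / 5 * (2 * u (chainPoint (k + 1)) - u (chainPoint k) - u (cutPoint k)) +
      (2 * u (chainPoint (k + 1)) - u (chainPoint (k + 2)) - u (cutPoint (k + 1))) = 0) :
    IsHarmonicIn halfDomain u := by
  refine ⟨fun w hw => ?_, fun v hv => ?_⟩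
  · obtain ⟨k, w', rfl⟩ := exists_eq_pWord_append fun x hx =>
      (mem_halfDomain_iff.1 (hw ⟨x, hx, rfl⟩)).2.1
    refine finiteEnergy_of_vertexHarmonic (m := 0) fun w₀ hw₀ => ?_
    rw [List.length_eq_zero_iff] at hw₀
    subst hw₀
    have h := (hu k).comp_cellMap w'
    intro a i j
    simpa only [Function.comp, cellMap_append, cellMap, id] using h a i j
  · obtain ⟨K, hK, hKΩ, hv0⟩ := hv.compact_support
    have hout : ∀ x ∈ SG, x ∉ halfDomain → v x = 0 := fun x hx hxΩ =>
      hv0 x ⟨hx, fun hxK => hxΩ (hKΩ hxK)⟩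
    have htail : ∃ n, ∀ y ∈ SG, v (cellMap (List.replicate n 0) y) = 0 := by
      rcases K.eq_empty_or_nonempty with rfl | hne
      · exact ⟨0, fun y hy => hv0 _ ⟨hy, by simp⟩⟩
      obtain ⟨z, hz, hmax⟩ := hK.exists_isMaxOn hne (continuous_bary 0).continuousOn
      have hzΩ := mem_halfDomain_iff.1 (hKΩ hz)
      have hz1 : bary 0 z < 1 := (bary_le_one hzΩ.1 0).lt_of_ne fun h => by
        have h1 := hzΩ.2.1
        rw [eq_q_of_bary_eq_one hzΩ.1 h, bary_q, bary_q] at h1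
        simp at h1
      obtain ⟨n, hn⟩ := exists_pow_lt_of_lt_one (sub_pos.2 hz1) (by norm_num : (1 / 2 : ℝ) < 1)
      refine ⟨n, fun y hy => hv0 _ ⟨cellMap_mem_SG _ hy, fun hyK => ?_⟩⟩
      have h1 : bary 0 (cellMap (List.replicate n 0) y) ≤ bary 0 z := hmax hyK
      rw [bary_cellMap_replicate_zero, if_pos rfl] at h1
      have := mul_nonneg (pow_nonneg (by norm_num : (0 : ℝ) ≤ 1 / 2) n) (bary_nonneg hy 0)
      linarith
    obtain ⟨n, hn⟩ := htail
    have hright : ∀ k < n, ∀ y ∈ SG, v (cellMap (List.replicate k 0) (F 2 y)) = 0 := by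
      intro k _ y hy
      refine hout _ (cellMap_mem_SG _ (F_mem_SG 2 hy)) fun h => ?_
      have h1 := (mem_halfDomain_iff.1 h).2.1
      rw [bary_cellMap_replicate_zero, bary_cellMap_replicate_zero, bary_F, bary_F] at h1
      simp only [Fin.reduceEq, if_false, if_true, add_zero] at h1
      have h2 := lt_of_mul_lt_mul_left h1 (by positivity)
      linarith [bary_le_one hy 1, bary_nonneg hy 2]
    have hcut : ∀ k, v (cutPoint k) = 0 := fun k =>
      hout _ (cutPoint_mem_SG k) fun h =>
        (mem_halfDomain_iff.1 h).2.1.ne (mem_cutSet_iff.1 (cutPoint_mem_cutSet k)).2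
    have hleft : v (chainPoint 0) = 0 := hout _ (q_mem_SG 1) fun h => h.2.2 rfl
    set c : ℕ → ℝ := fun k => (r⁻¹) ^ (k + 1) * (v (chainPoint k) *
      (2 * u (chainPoint k) - u (chainPoint (k + 1)) - u (cutPoint k))) with hc
    refine tendsto_const_nhds.congr' ?_
    filter_upwards [eventually_ge_atTop n] with m hnm
    rw [graphEnergy_eq_sum hu hright hn hnm, Finset.sum_congr rfl fun k _ =>
      (show _ = c k - c (k + 1) from ?_), Finset.sum_range_sub']
    · have hcn : v (chainPoint n) = 0 := hn _ (q_mem_SG 1)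
      simp [hc, hleft, hcn]
    · rw [energy₀_comp_pWord _ _ _ (hcut k)]
      have h1 : 2 * u (chainPoint (k + 1)) - u (chainPoint k) - u (cutPoint k) =
          -(r⁻¹ * (2 * u (chainPoint (k + 1)) - u (chainPoint (k + 2)) - u (cutPoint (k + 1)))) := by
        norm_num [r]
        linarith [hm k]
      simp only [hc]
      rw [h1, pow_succ _ (k + 1)]
      ring

end SierpinskiHalf

open SierpinskiHalf in
theorem theorem5p3 :
    -- the series converges for every continuous boundary function `f` with solution `u`
    (∀ (f : C(halfBoundary, ℝ)) (u : Plane → ℝ), IsDirichletSolution f u →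
      ∃ d : ℕ → ℝ, (∀ k, HasNormalDeriv u (pWord k) 2 (d k)) ∧
        SeriesConverges fun k => (3 / 5 : ℝ) ^ (k + 1) * d k) ∧
    -- every convergent series `η₋₁ + η₀ + η₁ + ⋯` comes from exactly one `f`
    (∀ (ηₘ₁ : ℝ) (η : ℕ → ℝ),
      (∃ s : ℝ, Tendsto (fun n : ℕ => ηₘ₁ + ∑ k ∈ Finset.range n, η k) atTop (𝓝 s)) →
      ∃! f : C(halfBoundary, ℝ), f leftVertex = 0 ∧
        ∃ u : Plane → ℝ, IsDirichletSolution f u ∧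
          HasNormalDeriv u [] 1 ηₘ₁ ∧
          ∀ k, HasNormalDeriv u (pWord k) 2 ((5 / 3 : ℝ) ^ (k + 1) * η k)) := by
  refine ⟨fun f u hu => ?_, fun ηₘ₁ η ⟨s, hs⟩ => ?_⟩
  · refine ⟨_, fun k => hasNormalDeriv_cutPoint
      (vertexHarmonic_comp_pWord hu.continuousOn hu.harmonic k), ?_⟩
    have h := seriesConverges_of_matching (tendsto_chainPoint hu.continuousOn)
      (tendsto_cutPoint hu.continuousOn) (matching hu.continuousOn hu.harmonic)
    convert h using 2 with k
    rw [← mul_assoc, ← mul_pow]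
    norm_num
  · obtain ⟨a, b, L, ha, hb, ha0, ha1, hab, hm⟩ := exists_chain_values ηₘ₁ η hs
    obtain ⟨g, hgc, hg, hga, hgb⟩ := exists_chain_function ha hb
    have hsub : halfDomain ∪ halfBoundary ⊆ SG := fun x hx =>
      (mem_halfDomain_union_halfBoundary_iff.1 hx).1
    have hgh : IsHarmonicIn halfDomain g := isHarmonicIn_of_matching hg fun k => by
      simpa only [hga, hgb] using hm k
    refine ⟨⟨fun x => g x, continuousOn_iff_continuous_domRestrict.1
      (hgc.mono (subset_union_right.trans hsub))⟩, ⟨?_, g, ⟨hgc.mono hsub, hgh, fun x => rfl⟩, ?_,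
      fun k => ?_⟩, ?_⟩
    · exact (hga 0).trans ha0
    · have h := hasNormalDeriv_leftVertex (hg 0)
      rw [hga, hga, hgb, ha1] at h
      convert h using 1
      ring
    · have h := hasNormalDeriv_cutPoint (hg k)
      rwa [hga, hga, hgb, hab] at h
    · -- the values of a solution on the chain and on the cut are determined by the data
      rintro f ⟨hf0, u, hu, hu1, hun⟩
      have hv := vertexHarmonic_comp_pWord hu.continuousOn hu.harmonic
      have h0 : u (chainPoint 0) = 0 := (hu.boundary leftVertex).trans hf0
      have h1 := tendsto_nhds_unique (hasNormalDeriv_leftVertex (hv 0)) hu1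
      have hcut : ∀ k, u (cutPoint k) = b k := chain_values_unique
        (u := fun k => u (chainPoint k)) (f := fun k => u (cutPoint k)) (by rw [h0, ha0])
        (by rw [ha1]; linarith) (fun k => by
          rw [hab]
          exact mul_left_cancel₀ (by positivity : (5 / 3 : ℝ) ^ (k + 1) ≠ 0)
            (tendsto_nhds_unique (hasNormalDeriv_cutPoint (hv k)) (hun k)))
        (matching hu.continuousOn hu.harmonic) hm
      ext ⟨x, hx⟩
      rw [← hu.boundary]
      change u x = g x
      rcases hx with rfl | hx
      · exact h0.trans ((hga 0).trans ha0).symm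
      · rcases eq_cutPoint_or_eq_q_zero hx with ⟨k, rfl⟩ | rfl
        · rw [hcut, hgb]
        · refine tendsto_nhds_unique (tendsto_cutPoint hu.continuousOn) ?_
          simpa only [hcut, hgb] using tendsto_cutPoint (hgc.mono hsub)
end
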